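/- Let $\mathbb{D}_1^\infty=\{\zeta\in\ell^1:|\zeta_j|<1\text{ for all }j\}$, a domain in the complex Banach space $\ell^1$. A function $F:\mathbb{D}_1^\infty\to\mathbb{C}$ is called analytic if it is locally bounded and, for all $\zeta\in\mathbb{D}_1^\infty$ and $\eta\in\ell^1$, the function $z\mapsto F(\zeta+z\eta)$ is analytic on $\{z\in\mathbb{C}:\zeta+z\eta\in\mathbb{D}_1^\infty\}$. For $1\le p<\infty$, let $\mathbf{H}^p_\infty$ be the set of all analytic $F$ on $\mathbb{D}_1^\infty$ with $$\|F\|_p^p=\sup_{0<r<1}\int_{\mathbb{T}^\infty}|F(rw_1,r^2w_2,\ldots,r^nw_n,\ldots)|^p\,\mathrm{d}m_\infty(w)<\infty,$$ where $m_\infty$ is the normalized Haar measure of the infinite torus $\mathbb{T}^\infty$. For $n=p_1^{\alpha_1}\cdots p_k^{\alpha_k}\ge 1$, where $p_j$ is the $j$-th prime, write $\zeta^{\alpha(n)}=\zeta_1^{\alpha_1}\cdots\zeta_k^{\alpha_k}$. Each analytic function $F$ on $\mathbb{D}_1^\infty$ has a unique absolutely convergent monomial expansion $F(\zeta)=\sum_{n=1}^\infty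 a_n\zeta^{\alpha(n)}$, $\zeta\in\mathbb{D}_1^\infty$. Given a sequence $\boldsymbol{X}=\{X_n\}_{n\ge1}$ of random variables on a probability space, the randomization of $F$ is the random series $$(\mathcal{R}F)(\zeta)=\sum_{n=1}^\infty a_nX_n\zeta^{\alpha(n)},$$ and $\mathcal{R}F\in\mathbf{H}^p_\infty$ means that this series converges absolutely at every point of $\mathbb{D}_1^\infty$ and that its sum is a function in $\mathbf{H}^p_\infty$. The sequence $\boldsymbol{X}$ is called a standard random sequence if the $X_n$ are independent and either $\mathbb{P}(X_n=1)=\mathbb{P}(X_n=-1)=\frac12$ for all $n$ (Bernoulli), or every $X_n$ is uniformly distributed on the unit circle $\mathbb{T}$ (Steinhaus), or every $X_n$ is a real Gaussian variable with mean $0$ and variance $1$ (Gaussian $N(0,1)$). **Theorem.** Let $\boldsymbol{X}$ be a standard random sequence and $F$ an analytic function on $\mathbb{D}_1^\infty$. (1) If $F\in\mathbf{H}^2_\infty$, then for all $1\le p<\infty$, $\mathcal{R}F\in\mathbf{H}^p_\infty$ almost surely. (2) If $F\notin\mathbf{H}^2_\infty$, then for all $1\le p<\infty$, $\mathcal{R}F\notin\mathbf{H}^p_\infty$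 almost surely. -/

import Mathlib

open MeasureTheory ProbabilityTheory Topology Set

open scoped ENNReal

noncomputable section

namespace InfHardy

/-- The complex Banach space `ℓ¹`. Coordinates are indexed by `ℕ`, so the coordinate written
`ζ_{j+1}` on paper is `ζ j` here. -/
abbrev Ell1 : Type := lp (fun _ : ℕ => ℂ) 1

/-- The domain `𝔻₁^∞ = 𝔻^∞ ∩ ℓ¹` of `ℓ¹`. -/
def polydisk : Set Ell1 := {ζ | ∀ j, ‖ζ j‖ < 1}

/-- Analytic functions on `𝔻₁^∞`: locally bounded, and analytic along every complex line.
Only the values of `F` on `𝔻₁^∞` matter. -/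
def IsAnalyticOnPolydisk (F : Ell1 → ℂ) : Prop :=
  (∀ ζ ∈ polydisk, ∃ U ∈ 𝓝 ζ, ∃ C : ℝ, ∀ ξ ∈ U ∩ polydisk, ‖F ξ‖ ≤ C) ∧
  ∀ ζ ∈ polydisk, ∀ η : Ell1,
    AnalyticOnNhd ℂ (fun z : ℂ => F (ζ + z • η)) {z : ℂ | ζ + z • η ∈ polydisk}

/-- The multi-index `α(n)`: `expo n j` is the exponent in `n` of the prime number with index `j`
(`Nat.nth Nat.Prime 0 = 2`, `Nat.nth Nat.Prime 1 = 3`, ...). -/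
def expo (n : ℕ+) (j : ℕ) : ℕ := (n : ℕ).factorization (Nat.nth Nat.Prime j)

/-- Prime numbers of index at least `n` do not divide `n`. -/
theorem expo_eq_zero_of_le {n : ℕ+} {j : ℕ} (h : (n : ℕ) ≤ j) : expo n j = 0 :=
  Nat.factorization_eq_zero_of_lt (by have := Nat.add_two_le_nth_prime j; omega)

/-- The monomial `ζ^{α(n)}`. By `expo_eq_zero_of_le` the product over `j < n` contains all the
factors that differ from `1`. -/
def monomial (n : ℕ+) (ζ : ℕ → ℂ) : ℂ := ∏ j ∈ Finset.range n, ζ j ^ expo n j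

/-- `F(ζ) = ∑_{n ≥ 1} a_n ζ^{α(n)}` for all `ζ ∈ 𝔻₁^∞`, with absolute (unconditional)
convergence. -/
def HasMonomialExpansion (F : Ell1 → ℂ) (a : ℕ+ → ℂ) : Prop :=
  ∀ ζ ∈ polydisk, HasSum (fun n : ℕ+ => a n * monomial n ζ) (F ζ)

open Classical in
/-- The coefficient sequence of the monomial expansion of `F`. (Every analytic function on
`𝔻₁^∞` has exactly one such expansion; the value `0` is used only for functions without one.) -/
def monomialCoeff (F : Ell1 → ℂ) : ℕ+ → ℂ :=
  if h : ∃ a, HasMonomialExpansion F a then h.choose else 0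

/-- The infinite torus `𝕋^∞`, each circle being parametrized by the angle: `t j ∈ ℝ/ℤ` stands for
the point `w_{j+1} = e^{2πi t j}` of the unit circle (see `circlePoint`). -/
abbrev Torus : Type := ℕ → UnitAddCircle

/-- The point `e^{2πi t}` of the unit circle in `ℂ`. -/
def circlePoint (t : UnitAddCircle) : ℂ := (AddCircle.toCircle t : ℂ)

/-- The normalized Haar measure `m_∞` on `𝕋^∞`, the product of the normalized arc length measures
`dθ_j/2π` of the circles. -/
def torusMeasure : Measure Torus :=
  Measure.infinitePi fun _ => (AddCircle.haarAddCircle : Measure UnitAddCircle)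

/-- The point `(r w₁, r² w₂, r³ w₃, ...)` of `ℓ¹`. -/
def dilatedPoint (r : Ioo (0 : ℝ) 1) (t : Torus) : Ell1 :=
  ⟨fun j => ((r : ℝ) : ℂ) ^ (j + 1) * circlePoint (t j), by
    refine memℓp_gen ?_
    have h : Summable fun j : ℕ => (r : ℝ) ^ (j + 1) :=
      (summable_nat_add_iff 1).2 (summable_geometric_of_lt_one r.2.1.le r.2.2)
    refine h.congr fun j => ?_
    have h1 : ‖circlePoint (t j)‖ = 1 := Circle.norm_coe _
    rw [norm_mul, h1, norm_pow, Complex.norm_real, Real.norm_of_nonneg r.2.1.le]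
    simp⟩

/-- `F_[r](w) = F(r w₁, r² w₂, ...)`. -/
def dilate (F : Ell1 → ℂ) (r : Ioo (0 : ℝ) 1) (t : Torus) : ℂ := F (dilatedPoint r t)

/-- `‖F‖_p^p = sup_{0<r<1} ∫ |F_[r]|^p dm_∞`, as an element of `[0, ∞]`. -/
def hardyNormPow (p : ℝ) (F : Ell1 → ℂ) : ℝ≥0∞ :=
  ⨆ r : Ioo (0 : ℝ) 1, ∫⁻ t, ‖dilate F r t‖ₑ ^ p ∂torusMeasure

/-- The Hardy space `H^p_∞` over `𝔻₁^∞`. -/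
def HardySpace (p : ℝ) : Set (Ell1 → ℂ) :=
  {F | IsAnalyticOnPolydisk F ∧ hardyNormPow p F < ∞}

/-- The series `∑ c_n ζ^{α(n)}` lies in `H^p_∞`: it converges on `𝔻₁^∞`, and its sum is a
function in `H^p_∞`. -/
def SeriesMemHardy (p : ℝ) (c : ℕ+ → ℂ) : Prop :=
  ∃ G ∈ HardySpace p, HasMonomialExpansion G c

variable {Ω : Type*} [MeasurableSpace Ω]

/-- `P(X_n = 1) = P(X_n = -1) = 1/2` for all `n`. -/
def IsBernoulliSeq (X : ℕ+ → Ω → ℂ) (P : Measure Ω) : Prop :=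
  ∀ n, P {ω | X n ω = 1} = 1 / 2 ∧ P {ω | X n ω = -1} = 1 / 2

/-- Every `X_n` is uniformly distributed on the unit circle. -/
def IsSteinhausSeq (X : ℕ+ → Ω → ℂ) (P : Measure Ω) : Prop :=
  ∀ n, P.map (X n) = (AddCircle.haarAddCircle : Measure UnitAddCircle).map circlePoint

/-- Every `X_n` is a real Gaussian variable with mean zero and variance one. -/
def IsGaussianSeq (X : ℕ+ → Ω → ℂ) (P : Measure Ω) : Prop :=
  ∀ n, P.map (X n) = (gaussianReal 0 1).map (fun x : ℝ => (x : ℂ))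

/-- A standard random sequence: independent random variables that form a standard Bernoulli,
Steinhaus or Gaussian `N(0,1)` sequence (hence are identically distributed). -/
def IsStandardRandomSeq (X : ℕ+ → Ω → ℂ) (P : Measure Ω) : Prop :=
  (∀ n, Measurable (X n)) ∧ iIndepFun X P ∧
    (IsBernoulliSeq X P ∨ IsSteinhausSeq X P ∨ IsGaussianSeq X P)

/-- The coefficients `a_n X_n(ω)` of the randomization
`(RF)(ζ) = ∑ a_n X_n ζ^{α(n)}` at the sample point `ω`. -/
def randomCoeff (F : Ell1 → ℂ) (X : ℕ+ → Ω → ℂ) (ω : Ω) : ℕ+ → ℂ :=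
  fun n => monomialCoeff F n * X n ω

end InfHardy

end

/-!
Let `F(ζ) = ∑ a_n ζ^{α(n)}` be analytic on `𝔻₁^∞`. Parseval's identity on the infinite torus gives
`‖F‖₂² = ∑ |a_n|²` (`HasMonomialExpansion.hardyNormPow_two`), so the theorem compares the square
summability of the coefficients with the behaviour of the random series `∑ a_n X_n ζ^{α(n)}`.

**The monomial expansion.** Integrating `F` against characters of the torus, one coordinate at a
time, produces coefficients that do not depend on the radii (`cauchyCoeff_eq`), and Cauchy's formula
gives the expansion at finitely supported points (`hasSum_taylorCoeff_of_finite`). For absolute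
convergence at a point `ζ` (`IsAnalyticOnPolydisk.summable_taylorCoeff`) one uses that the polydisc
`{|κ_j| ≤ |ζ_j|}` is compact in `ℓ¹`, so that `F` is bounded on a uniform neighbourhood of it, and
Cauchy estimates with radii that depend on `n`. Outside finitely many variables they bound
the `n`-th term by a multinomial coefficient times `∏ y_j^{e_j}` with `∑ y_j < 1`, and the
multinomial theorem sums these bounds. The general point follows by truncation, since local
boundedness and analyticity along lines imply continuity.

**Square summable coefficients.** Almost surely `∑ |a_n X_n|² < ∞`, and square summable coefficients
define an analytic function (`exists_analytic_of_summable_sq`). By the Khintchine inequality, which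
holds for all standard sequences because the real parts of the multiples of `X_n` are subgaussian,
the expected `2k`-th power means over the dilated tori are bounded uniformly in the radius. These
means increase with the radius, by Parseval's identity for the `k`-th power of the function
(`IsAnalyticOnPolydisk.lintegral_dilate_even_mono`), so monotone convergence bounds the expectation
of their supremum.

**Coefficients that are not square summable.** Membership in `H^p` bounds the `L¹` means of the
partial sums. The event that these means are bounded is a tail event, hence has probability zero or
one. If it had probability one, they would be at most some `M` with probability close to one,
uniformly in the radius. The second and fourth moments of a random sum show that its first moment
over any event of probability close to one is comparable with its standard deviation
(`IsSubgaussianSeq.le_setIntegral_norm`), so that `∑ |a_n|²` would be finite.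
-/

noncomputable section

namespace InfHardy

/-! ### Monomials and their sum over all indices -/

theorem monomial_eq_prod_range {n : ℕ+} {s : ℕ} (h : (n : ℕ) ≤ s) (ζ : ℕ → ℂ) :
    monomial n ζ = ∏ j ∈ Finset.range s, ζ j ^ expo n j := by
  refine Finset.prod_subset (Finset.range_mono h) fun j _ hj => ?_
  rw [expo_eq_zero_of_le (by simpa using hj), pow_zero]

theorem expo_one (j : ℕ) : expo 1 j = 0 := by simp [expo]

theorem expo_mul (n m : ℕ+) (j : ℕ) : expo (n * m) j = expo n j + expo m j := by
  simp [expo, Nat.factorization_mul]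

theorem monomial_one (ζ : ℕ → ℂ) : monomial 1 ζ = 1 := by simp [monomial, expo_one]

theorem monomial_index_mul (n m : ℕ+) (ζ : ℕ → ℂ) :
    monomial (n * m) ζ = monomial n ζ * monomial m ζ := by
  have hn : (n : ℕ) ≤ (n * m : ℕ+) := by
    rw [PNat.mul_coe]; exact Nat.le_mul_of_pos_right _ m.pos
  have hm : (m : ℕ) ≤ (n * m : ℕ+) := by
    rw [PNat.mul_coe]; exact Nat.le_mul_of_pos_left _ n.pos
  rw [monomial_eq_prod_range le_rfl, monomial_eq_prod_range hn, monomial_eq_prod_range hm,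
    ← Finset.prod_mul_distrib]
  simp [expo_mul, pow_add]

theorem monomial_mul (n : ℕ+) (ζ η : ℕ → ℂ) :
    monomial n (fun j => ζ j * η j) = monomial n ζ * monomial n η := by
  simp [monomial, mul_pow, Finset.prod_mul_distrib]

/-- The monomial `x^{α(n)}` of a sequence of real numbers. -/
def realMonomial (n : ℕ+) (x : ℕ → ℝ) : ℝ := ∏ j ∈ Finset.range n, x j ^ expo n j

theorem norm_monomial (n : ℕ+) (ζ : ℕ → ℂ) :
    ‖monomial n ζ‖ = realMonomial n (fun j => ‖ζ j‖) := by
  simp [monomial, realMonomial, norm_prod]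

theorem monomial_ofReal (n : ℕ+) (x : ℕ → ℝ) :
    monomial n (fun j => (x j : ℂ)) = (realMonomial n x : ℂ) := by
  simp [monomial, realMonomial]

theorem realMonomial_nonneg (n : ℕ+) {x : ℕ → ℝ} (hx : ∀ j, 0 ≤ x j) : 0 ≤ realMonomial n x :=
  Finset.prod_nonneg fun j _ => pow_nonneg (hx j) _

theorem realMonomial_pos (n : ℕ+) {x : ℕ → ℝ} (hx : ∀ j, expo n j ≠ 0 → 0 < x j) :
    0 < realMonomial n x := by
  refine Finset.prod_pos fun j _ => ?_
  by_cases h : expo n j = 0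
  · simp [h]
  · exact pow_pos (hx j h) _

theorem realMonomial_mono (n : ℕ+) {x y : ℕ → ℝ} (hx : ∀ j, 0 ≤ x j) (h : ∀ j, x j ≤ y j) :
    realMonomial n x ≤ realMonomial n y :=
  Finset.prod_le_prod (fun j _ => pow_nonneg (hx j) _)
    fun j _ => pow_le_pow_left₀ (hx j) (h j) _

theorem realMonomial_le_one (n : ℕ+) {x : ℕ → ℝ} (hx : ∀ j, 0 ≤ x j) (h : ∀ j, x j ≤ 1) :
    realMonomial n x ≤ 1 :=
  Finset.prod_le_one (fun j _ => pow_nonneg (hx j) _) fun j _ => pow_le_one₀ (hx j) (h j)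

theorem norm_circlePoint (t : UnitAddCircle) : ‖circlePoint t‖ = 1 := Circle.norm_coe _

theorem norm_monomial_circlePoint (n : ℕ+) (t : Torus) :
    ‖monomial n (fun j => circlePoint (t j))‖ = 1 := by
  simp [norm_monomial, norm_circlePoint, realMonomial]

theorem expo_nth_prime {j : ℕ} (h : 0 < Nat.nth Nat.Prime j) (i : ℕ) :
    expo ⟨Nat.nth Nat.Prime j, h⟩ i = if i = j then 1 else 0 := by
  have hp := Nat.prime_nth_prime j
  simp only [expo, PNat.mk_coe, hp.factorization]
  rw [Finsupp.single_apply]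
  refine if_congr ?_ rfl rfl
  exact ⟨fun h => (Nat.nth_injective Nat.infinite_setOfPred_prime h).symm, fun h => by rw [h]⟩

theorem monomial_nth_prime {j : ℕ} (h : 0 < Nat.nth Nat.Prime j) (ζ : ℕ → ℂ) :
    monomial ⟨Nat.nth Nat.Prime j, h⟩ ζ = ζ j := by
  have hj : j < Nat.nth Nat.Prime j := by have := Nat.add_two_le_nth_prime j; omega
  simp only [monomial, expo_nth_prime, PNat.mk_coe]
  rw [Finset.prod_eq_single j]
  · simp
  · intro i _ hi; simp [hi]
  · intro hj'; simp [hj] at hj'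

theorem expo_ext {n m : ℕ+} (h : ∀ j, expo n j = expo m j) : n = m := by
  refine PNat.eq (Nat.eq_of_factorization_eq n.ne_zero m.ne_zero fun p => ?_)
  by_cases hp : p.Prime
  · simpa [expo, Nat.nth_count hp] using h (Nat.count Nat.Prime p)
  · simp [Nat.factorization_eq_zero_of_not_prime, hp]

/-- The monomials at a fixed point, as a completely multiplicative function of `n ∈ ℕ`. -/
def monomialHom (ζ : ℕ → ℂ) : ℕ →* ℂ where
  toFun n := if h : 0 < n then monomial ⟨n, h⟩ ζ else 0
  map_one' := by
    rw [dif_pos Nat.one_pos]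
    exact monomial_one ζ
  map_mul' m n := by
    by_cases hm : 0 < m
    · by_cases hn : 0 < n
      · rw [dif_pos hm, dif_pos hn, dif_pos (Nat.mul_pos hm hn)]
        exact monomial_index_mul ⟨m, hm⟩ ⟨n, hn⟩ ζ
      · simp [hn]
    · simp [hm]

theorem monomialHom_coe (ζ : ℕ → ℂ) (n : ℕ+) : monomialHom ζ n = monomial n ζ := by
  exact dif_pos n.pos

theorem monomialHom_nth_prime (ζ : ℕ → ℂ) (j : ℕ) :
    monomialHom ζ (Nat.nth Nat.Prime j) = ζ j := by
  have h : 0 < Nat.nth Nat.Prime j := (Nat.prime_nth_prime j).pos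
  exact (monomialHom_coe ζ ⟨_, h⟩).trans (monomial_nth_prime h ζ)

/-- Euler product: for a finitely supported point `ζ` of the polydisk, the monomials `ζ^{α(n)}` sum
to `∏ (1 - ζ_j)⁻¹`. -/
theorem hasSum_monomial_of_finite {ζ : ℕ → ℂ} {s : ℕ} (h1 : ∀ j, ‖ζ j‖ < 1)
    (h0 : ∀ j, s ≤ j → ζ j = 0) :
    Summable (fun n : ℕ+ => ‖monomial n ζ‖) ∧
      HasSum (fun n : ℕ+ => monomial n ζ) (∏ j ∈ Finset.range s, (1 - ζ j)⁻¹) := by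
  have hlt : ∀ {p : ℕ}, p.Prime → ‖monomialHom ζ p‖ < 1 := by
    intro p hp
    rw [← Nat.nth_count hp, monomialHom_nth_prime]
    exact h1 _
  have hinj : Function.Injective (Nat.nth Nat.Prime) :=
    Nat.nth_injective Nat.infinite_setOfPred_prime
  set S : Finset ℕ := (Finset.range s).image (Nat.nth Nat.Prime) with hS
  obtain ⟨hs, hh⟩ :=
    EulerProduct.summable_and_hasSum_factoredNumbers_prod_filter_prime_geometric hlt S
  have hprod : ∏ p ∈ S with p.Prime, (1 - monomialHom ζ p)⁻¹
      = ∏ j ∈ Finset.range s, (1 - ζ j)⁻¹ := by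
    rw [Finset.filter_true_of_mem, hS, Finset.prod_image hinj.injOn]
    · simp [monomialHom_nth_prime]
    · intro p hp
      obtain ⟨j, -, rfl⟩ := Finset.mem_image.1 hp
      exact Nat.prime_nth_prime j
  rw [hprod] at hh
  let ι : Nat.factoredNumbers S → ℕ+ := fun m => ⟨m, Nat.pos_of_ne_zero m.2.1⟩
  have hι : Function.Injective ι := fun a b hab => Subtype.ext (congrArg PNat.val hab)
  have hcomp : ∀ m, monomial (ι m) ζ = monomialHom ζ m := fun m => (monomialHom_coe ζ (ι m)).symm
  have hzero : ∀ n, n ∉ Set.range ι → monomial n ζ = 0 := by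
    intro n hn
    have : ¬ ((n : ℕ) ∈ Nat.factoredNumbers S) := fun h => hn ⟨⟨n, h⟩, rfl⟩
    rw [Nat.mem_factoredNumbers'] at this
    push Not at this
    obtain ⟨p, hp, hpn, hpS⟩ := this
    rw [← Nat.nth_count hp] at hpn hpS
    set j := Nat.count Nat.Prime p
    have hj : s ≤ j := by
      by_contra hlt
      exact hpS (Finset.mem_image_of_mem _ (Finset.mem_range.2 (by omega)))
    have he : expo n j ≠ 0 :=
      ((Nat.prime_nth_prime j).factorization_pos_of_dvd n.ne_zero hpn).ne'
    have hjn : j < n := by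
      by_contra hle
      exact he (expo_eq_zero_of_le (by omega))
    exact Finset.prod_eq_zero (Finset.mem_range.2 hjn) (by rw [h0 j hj, zero_pow he])
  constructor
  · rw [← hι.summable_iff (fun n hn => by rw [hzero n hn, norm_zero])]
    simpa [Function.comp_def, hcomp] using hs
  · rw [← hι.hasSum_iff hzero]
    simpa [Function.comp_def, hcomp] using hh

/-- The sum of all monomials at a point with `|x_j| ≤ q < 1` is at most
`exp (∑ x_j / (1 - q))`. -/
theorem sum_realMonomial_le {x : ℕ → ℝ} {q : ℝ} (hq : q < 1) (h0 : ∀ j, 0 ≤ x j)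
    (hx : ∀ j, x j ≤ q) (hs : Summable x) (T : Finset ℕ+) :
    ∑ n ∈ T, realMonomial n x ≤ Real.exp ((∑' j, x j) / (1 - q)) := by
  set s : ℕ := T.sup (fun n => (n : ℕ)) with hs'
  set y : ℕ → ℝ := fun j => if j < s then x j else 0 with hy
  have hy0 : ∀ j, 0 ≤ y j := fun j => by simp only [hy]; split_ifs <;> simp [h0]
  have hyx : ∀ j, y j ≤ x j := fun j => by simp only [hy]; split_ifs <;> simp [h0]
  have hq0 : 0 ≤ q := (h0 0).trans (hx 0)
  have hE := hasSum_monomial_of_finite (ζ := fun j => (y j : ℂ)) (s := s)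
    (fun j => by
      rw [Complex.norm_real, Real.norm_of_nonneg (hy0 j)]
      exact ((hyx j).trans (hx j)).trans_lt hq)
    (fun j hj => by simp [hy, not_lt.2 hj])
  have hsum : HasSum (fun n : ℕ+ => realMonomial n y) (∏ j ∈ Finset.range s, (1 - y j)⁻¹) := by
    rw [← Complex.hasSum_ofReal]
    convert hE.2 using 1
    · ext n; rw [monomial_ofReal]
    · push_cast; rfl
  calc ∑ n ∈ T, realMonomial n x = ∑ n ∈ T, realMonomial n y := by
        refine Finset.sum_congr rfl fun n hn => Finset.prod_congr rfl fun j hj => ?_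
        have h1 : (n : ℕ) ≤ s := Finset.le_sup (f := fun n : ℕ+ => (n : ℕ)) hn
        have h2 : j < n := Finset.mem_range.1 hj
        simp [hy, h2.trans_le h1]
    _ ≤ ∏ j ∈ Finset.range s, (1 - y j)⁻¹ :=
        sum_le_hasSum T (fun n _ => realMonomial_nonneg n hy0) hsum
    _ ≤ ∏ j ∈ Finset.range s, Real.exp (x j / (1 - q)) := by
        refine Finset.prod_le_prod (fun j _ => ?_) fun j _ => ?_
        · exact inv_nonneg.2 (by linarith [hyx j, hx j])
        · have hyq : y j ≤ q := (hyx j).trans (hx j)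
          have h1 : 0 < 1 - y j := by linarith
          have h2 : 0 < 1 - q := by linarith
          calc (1 - y j)⁻¹ = y j / (1 - y j) + 1 := by field_simp; ring
            _ ≤ x j / (1 - q) + 1 := by
              gcongr
              · exact h0 j
              · exact hyx j
            _ ≤ _ := Real.add_one_le_exp _
    _ = Real.exp (∑ j ∈ Finset.range s, x j / (1 - q)) := (Real.exp_sum _ _).symm
    _ ≤ _ := by
        rw [← Finset.sum_div]
        have h2 : 0 ≤ 1 - q := by linarith
        gcongr
        exact hs.sum_le_tsum _ fun j _ => h0 j

theorem summable_realMonomial {x : ℕ → ℝ} {q : ℝ} (hq : q < 1) (h0 : ∀ j, 0 ≤ x j)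
    (hx : ∀ j, x j ≤ q) (hs : Summable x) : Summable fun n : ℕ+ => realMonomial n x :=
  summable_of_sum_le (fun n => realMonomial_nonneg n h0) (sum_realMonomial_le hq h0 hx hs)

/-! ### The space of absolutely summable sequences and continuity of analytic functions -/

/-- An absolutely summable sequence as an element of `ℓ¹`. -/
def ell1Of (x : ℕ → ℂ) (h : Summable fun j => ‖x j‖) : Ell1 :=
  ⟨x, memℓp_gen (by simpa using h)⟩

@[simp] theorem ell1Of_apply (x : ℕ → ℂ) (h : Summable fun j => ‖x j‖) (j : ℕ) :
    ell1Of x h j = x j := rfl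

theorem ell1_hasSum_norm (ζ : Ell1) : HasSum (fun j => ‖ζ j‖) ‖ζ‖ := by
  simpa using lp.hasSum_norm (p := 1) (by simp) ζ

theorem continuous_ell1Of {T : Type*} [TopologicalSpace T] {x : T → ℕ → ℂ} {u : ℕ → ℝ}
    (hu : Summable u) (hx : ∀ j, Continuous fun t => x t j) (hb : ∀ t j, ‖x t j‖ ≤ u j)
    (h : ∀ t, Summable fun j => ‖x t j‖) : Continuous fun t => ell1Of (x t) (h t) := by
  have key : ∀ t, ell1Of (x t) (h t) = ∑' j, lp.single 1 j (x t j) := fun t =>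
    (lp.hasSum_single (p := 1) (by simp) (ell1Of (x t) (h t))).tsum_eq.symm
  simp_rw [key]
  refine continuous_tsum (fun j => ?_) hu fun j t => ?_
  · exact (lp.isometry_single (E := fun _ : ℕ => ℂ) (p := 1) j).continuous.comp (hx j)
  · rw [lp.norm_single (by simp)]
    exact hb t j

theorem exists_lt_one_of_mem_polydisk {ζ : Ell1} (h : ζ ∈ polydisk) :
    ∃ q : ℝ, 0 < q ∧ q < 1 ∧ ∀ j, ‖ζ j‖ ≤ q := by
  have h0 := (ell1_hasSum_norm ζ).summable.tendsto_atTop_zero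
  obtain ⟨N, hN⟩ := Filter.eventually_atTop.1 (h0.eventually (gt_mem_nhds (one_half_pos (α := ℝ))))
  obtain ⟨i, -, hi⟩ := Finset.exists_max_image (Finset.range (N + 1)) (fun j => ‖ζ j‖)
    ⟨0, by simp⟩
  refine ⟨max (1 / 2) ‖ζ i‖, by positivity, max_lt (by norm_num) (h i), fun j => ?_⟩
  rcases le_or_gt N j with hj | hj
  · exact (hN j hj).le.trans (le_max_left _ _)
  · exact (hi j (Finset.mem_range.2 (by omega))).trans (le_max_right _ _)

theorem ball_subset_polydisk {ζ : Ell1} {q : ℝ} (h : ∀ j, ‖ζ j‖ ≤ q) :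
    Metric.ball ζ (1 - q) ⊆ polydisk := by
  intro ξ hξ j
  have h1 : ‖(ξ - ζ) j‖ ≤ ‖ξ - ζ‖ := lp.norm_apply_le_norm (by simp) _ j
  rw [mem_ball_iff_norm] at hξ
  calc ‖ξ j‖ = ‖ζ j + (ξ - ζ) j‖ := by simp
    _ ≤ ‖ζ j‖ + ‖(ξ - ζ) j‖ := norm_add_le _ _
    _ < 1 := by linarith [h j]

theorem isOpen_polydisk : IsOpen polydisk := by
  refine Metric.isOpen_iff.2 fun ζ hζ => ?_
  obtain ⟨q, -, hq, h⟩ := exists_lt_one_of_mem_polydisk hζ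
  exact ⟨1 - q, by linarith, ball_subset_polydisk h⟩

theorem dilatedPoint_apply (r : Ioo (0 : ℝ) 1) (t : Torus) (j : ℕ) :
    dilatedPoint r t j = ((r : ℝ) : ℂ) ^ (j + 1) * circlePoint (t j) := rfl

theorem norm_dilatedPoint_apply (r : Ioo (0 : ℝ) 1) (t : Torus) (j : ℕ) :
    ‖dilatedPoint r t j‖ = (r : ℝ) ^ (j + 1) := by
  rw [dilatedPoint_apply, norm_mul, norm_circlePoint, norm_pow, Complex.norm_real,
    Real.norm_of_nonneg r.2.1.le, mul_one]

theorem dilatedPoint_mem (r : Ioo (0 : ℝ) 1) (t : Torus) : dilatedPoint r t ∈ polydisk := by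
  intro j
  rw [norm_dilatedPoint_apply]
  exact pow_lt_one₀ r.2.1.le r.2.2 (by omega)

theorem IsAnalyticOnPolydisk.exists_ball_bound {F : Ell1 → ℂ} (hF : IsAnalyticOnPolydisk F)
    {ζ : Ell1} (hζ : ζ ∈ polydisk) :
    ∃ δ > 0, ∃ C : ℝ, Metric.ball ζ δ ⊆ polydisk ∧ ∀ ξ ∈ Metric.ball ζ δ, ‖F ξ‖ ≤ C := by
  obtain ⟨U, hU, C, hC⟩ := hF.1 ζ hζ
  obtain ⟨δ, hδ, h⟩ := Metric.mem_nhds_iff.1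
    (Filter.inter_mem hU (isOpen_polydisk.mem_nhds hζ))
  exact ⟨δ, hδ, C, fun ξ hξ => (h hξ).2, fun ξ hξ => hC ξ (h hξ)⟩

/-- Local boundedness and analyticity along lines give continuity, by the Schwarz lemma on the
lines through a point. -/
theorem IsAnalyticOnPolydisk.continuousOn {F : Ell1 → ℂ} (hF : IsAnalyticOnPolydisk F) :
    ContinuousOn F polydisk := by
  intro ζ hζ
  refine ContinuousAt.continuousWithinAt ?_
  obtain ⟨δ, hδ, C, hsub, hC⟩ := hF.exists_ball_bound hζ
  have hC0 : 0 ≤ C := (norm_nonneg _).trans (hC ζ (Metric.mem_ball_self hδ))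
  have key : ∀ ξ ∈ Metric.ball ζ δ, dist (F ξ) (F ζ) ≤ (2 * C + 1) / δ * dist ξ ζ := by
    intro ξ hξ
    rcases eq_or_ne ξ ζ with rfl | hne
    · simp
    have hpos : 0 < ‖ξ - ζ‖ := norm_pos_iff.2 (sub_ne_zero.2 hne)
    set η : Ell1 := ((‖ξ - ζ‖⁻¹ : ℝ) : ℂ) • (ξ - ζ) with hη
    have hη1 : ‖η‖ = 1 := by
      rw [hη, norm_smul, Complex.norm_real, Real.norm_of_nonneg (by positivity)]
      exact inv_mul_cancel₀ hpos.ne'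
    have hmem : ∀ z ∈ Metric.ball (0 : ℂ) δ, ζ + z • η ∈ Metric.ball ζ δ := by
      intro z hz
      rw [mem_ball_iff_norm, add_sub_cancel_left, norm_smul, hη1, mul_one]
      simpa using hz
    have hd : DifferentiableOn ℂ (fun z : ℂ => F (ζ + z • η)) (Metric.ball 0 δ) :=
      fun z hz => (hF.2 ζ hζ η z (hsub (hmem z hz))).differentiableAt.differentiableWithinAt
    have hmaps : MapsTo (fun z : ℂ => F (ζ + z • η)) (Metric.ball 0 δ)
        (Metric.ball (F (ζ + (0 : ℂ) • η)) (2 * C + 1)) := by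
      intro z hz
      rw [mem_ball_iff_norm]
      have h1 := hC _ (hmem z hz)
      have h2 := hC _ (hmem 0 (Metric.mem_ball_self hδ))
      have := norm_sub_le (F (ζ + z • η)) (F (ζ + (0 : ℂ) • η))
      linarith
    have hz : ((‖ξ - ζ‖ : ℝ) : ℂ) ∈ Metric.ball (0 : ℂ) δ := by
      rw [mem_ball_zero_iff, Complex.norm_real, Real.norm_of_nonneg hpos.le]
      exact mem_ball_iff_norm.1 hξ
    have := Complex.dist_le_div_mul_dist_of_mapsTo_ball hd (hmaps.mono_right
      Metric.ball_subset_closedBall) hz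
    have e1 : ζ + ((‖ξ - ζ‖ : ℝ) : ℂ) • η = ξ := by
      rw [hη, smul_smul, ← Complex.ofReal_mul, mul_inv_cancel₀ hpos.ne']
      simp
    rw [e1] at this
    simpa [dist_eq_norm] using this
  rw [ContinuousAt, tendsto_iff_dist_tendsto_zero]
  have hlim : Filter.Tendsto (fun ξ => (2 * C + 1) / δ * dist ξ ζ) (𝓝 ζ) (𝓝 0) := by
    have : Filter.Tendsto (fun ξ => (2 * C + 1) / δ * dist ξ ζ) (𝓝 ζ)
        (𝓝 ((2 * C + 1) / δ * dist ζ ζ)) :=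
      (continuous_const.mul (continuous_id.dist continuous_const)).tendsto ζ
    simpa using this
  refine squeeze_zero' (Filter.Eventually.of_forall fun _ => dist_nonneg) ?_ hlim
  filter_upwards [Metric.ball_mem_nhds ζ hδ] with ξ hξ using key ξ hξ

theorem IsAnalyticOnPolydisk.pow {F : Ell1 → ℂ} (hF : IsAnalyticOnPolydisk F) (k : ℕ) :
    IsAnalyticOnPolydisk (fun ζ => F ζ ^ k) := by
  refine ⟨fun ζ hζ => ?_, fun ζ hζ η => (hF.2 ζ hζ η).pow k⟩
  obtain ⟨U, hU, C, hC⟩ := hF.1 ζ hζ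
  refine ⟨U, hU, C ^ k, fun ξ hξ => ?_⟩
  rw [norm_pow]
  exact pow_le_pow_left₀ (norm_nonneg _) (hC ξ hξ) k

/-- The point `ξ` with its coordinate `j` replaced by `z`. -/
def setCoord (ξ : Ell1) (j : ℕ) (z : ℂ) : Ell1 := ξ + lp.single 1 j (z - ξ j)

theorem setCoord_apply (ξ : Ell1) (j : ℕ) (z : ℂ) (i : ℕ) :
    setCoord ξ j z i = if i = j then z else ξ i := by
  have : setCoord ξ j z i = ξ i + lp.single (E := fun _ : ℕ => ℂ) 1 j (z - ξ j) i := rfl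
  rw [this, lp.single_apply]
  split_ifs with h
  · subst h; simp
  · simp [h]

theorem IsAnalyticOnPolydisk.differentiableOn_setCoord {F : Ell1 → ℂ}
    (hF : IsAnalyticOnPolydisk F) {ξ : Ell1} (hξ : ξ ∈ polydisk) (j : ℕ) :
    DifferentiableOn ℂ (fun z => F (setCoord ξ j z)) (Metric.ball 0 1) := by
  have hmem : ∀ z ∈ Metric.ball (0 : ℂ) 1, setCoord ξ j z ∈ polydisk := by
    intro z hz i
    rw [setCoord_apply]
    split_ifs
    · simpa using hz
    · exact hξ i
  have e : ∀ z, setCoord ξ j z = setCoord ξ j 0 + z • lp.single 1 j (1 : ℂ) := by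
    intro z
    simp only [setCoord]
    rw [add_assoc, ← lp.single_smul, ← lp.single_add]
    simp [sub_eq_neg_add]
  intro z hz
  have h := (hF.2 _ (hmem 0 (by simp)) (lp.single 1 j 1) z (by
    rw [mem_ofPred_eq, ← e]; exact hmem z hz)).differentiableAt
  simp_rw [← e] at h
  exact h.differentiableWithinAt

/-! ### Integration over the infinite torus and Parseval's identity -/

instance : IsProbabilityMeasure torusMeasure := by unfold torusMeasure; infer_instance

theorem continuous_circlePoint : Continuous circlePoint :=
  continuous_subtype_val.comp AddCircle.continuous_toCircle

theorem circlePoint_ne_zero (t : UnitAddCircle) : circlePoint t ≠ 0 :=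
  norm_ne_zero_iff.1 (by rw [norm_circlePoint]; exact one_ne_zero)

theorem continuous_monomial_circlePoint (n : ℕ+) :
    Continuous fun t : Torus => monomial n fun j => circlePoint (t j) :=
  continuous_finsetProd _ fun j _ => (continuous_circlePoint.comp (continuous_apply j)).pow _

theorem integrable_torus {f : Torus → ℂ} (hf : Continuous f) : Integrable f torusMeasure :=
  hf.integrable_of_hasCompactSupport (HasCompactSupport.of_compactSpace f)

/-- Resampling one coordinate of a random point of the torus does not change its law. -/
theorem measurePreserving_update (j : ℕ) :
    MeasurePreserving (fun p : Torus × UnitAddCircle => Function.update p.1 j p.2)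
      (torusMeasure.prod AddCircle.haarAddCircle) torusMeasure := by
  have hmeas : Measurable (fun p : Torus × UnitAddCircle => Function.update p.1 j p.2) := by
    refine measurable_pi_iff.2 fun i => ?_
    rcases eq_or_ne i j with rfl | h
    · simpa using measurable_snd
    · simp only [ne_eq, h, not_false_eq_true, Function.update_of_ne]
      exact (measurable_pi_apply i).comp measurable_fst
  refine ⟨hmeas, Measure.eq_infinitePi _ fun s t ht => ?_⟩
  have hpi : ∀ u : Finset ℕ, MeasurableSet (Set.pi (u : Set ℕ) t) := fun u =>
    MeasurableSet.pi u.countable_toSet fun i _ => ht i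
  rw [Measure.map_apply hmeas (hpi s)]
  by_cases hj : j ∈ s
  · have e : (fun p : Torus × UnitAddCircle => Function.update p.1 j p.2) ⁻¹' Set.pi (s : Set ℕ) t
        = Set.pi ((s.erase j : Finset ℕ) : Set ℕ) t ×ˢ t j := by
      ext ⟨w, v⟩
      simp only [mem_preimage, Set.mem_pi, mem_prod, Finset.mem_coe, Finset.mem_erase]
      constructor
      · refine fun h => ⟨fun i hi => ?_, by simpa using h j hj⟩
        simpa [hi.1] using h i hi.2
      · rintro ⟨h1, h2⟩ i hi
        rcases eq_or_ne i j with rfl | h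
        · simpa using h2
        · simpa [h] using h1 i ⟨h, hi⟩
    rw [e, Measure.prod_prod, torusMeasure, Measure.infinitePi_pi _ (fun i _ => ht i),
      Finset.prod_erase_mul s (fun i => (AddCircle.haarAddCircle : Measure UnitAddCircle) (t i)) hj]
  · have e : (fun p : Torus × UnitAddCircle => Function.update p.1 j p.2) ⁻¹' Set.pi (s : Set ℕ) t
        = Set.pi (s : Set ℕ) t ×ˢ univ := by
      ext ⟨w, v⟩
      simp only [mem_preimage, Set.mem_pi, mem_prod, Finset.mem_coe, mem_univ, and_true]
      refine forall₂_congr fun i hi => ?_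
      have : i ≠ j := fun h => hj (h ▸ hi)
      simp [this]
    rw [e, Measure.prod_prod, torusMeasure, Measure.infinitePi_pi _ (fun i _ => ht i),
      measure_univ, mul_one]

theorem integral_torus_update {f : Torus → ℂ} (hf : Continuous f) (j : ℕ) :
    ∫ t, f t ∂torusMeasure
      = ∫ t, ∫ v, f (Function.update t j v) ∂AddCircle.haarAddCircle ∂torusMeasure := by
  have hmp := measurePreserving_update j
  have hi := integrable_torus hf
  conv_lhs => rw [← hmp.map_eq]
  rw [integral_map hmp.measurable.aemeasurable
    (by rw [hmp.map_eq]; exact hi.aestronglyMeasurable)]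
  exact integral_prod _ (hmp.integrable_comp_of_integrable hi)

theorem circlePoint_coe (x : ℝ) :
    circlePoint (x : UnitAddCircle) = circleMap 0 1 (2 * Real.pi * x) := by
  rw [circlePoint, AddCircle.toCircle_apply_mk]
  simp [circleMap]

theorem integral_circlePoint (f : ℂ → ℂ) :
    ∫ v, f (circlePoint v) ∂(AddCircle.haarAddCircle : Measure UnitAddCircle)
      = Real.circleAverage f 0 1 := by
  rw [AddCircle.integral_haarAddCircle, ← AddCircle.intervalIntegral_preimage 1 0,
    Real.circleAverage]
  simp_rw [circlePoint_coe]
  have := intervalIntegral.integral_comp_mul_left (a := 0) (b := 1)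
    (fun θ => f (circleMap 0 1 θ)) (c := 2 * Real.pi) (by positivity)
  simp only [zero_add, inv_one, one_smul]
  rw [this]
  simp

theorem integral_circlePoint_pow_conj {a b : ℕ} (h : a ≠ b) :
    ∫ v, circlePoint v ^ a * (starRingEnd ℂ) (circlePoint v) ^ b
      ∂(AddCircle.haarAddCircle : Measure UnitAddCircle) = 0 := by
  have hk : ((a : ℤ) - b) ≠ 0 := by omega
  have e : ∀ v : UnitAddCircle, circlePoint v ^ a * (starRingEnd ℂ) (circlePoint v) ^ b
      = fourier ((a : ℤ) - b) v := by
    intro v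
    rw [sub_eq_add_neg, fourier_add, fourier_neg, ← map_pow]
    simp [fourier_apply, circlePoint, AddCircle.toCircle_nsmul]
  simp_rw [e]
  exact integral_eq_zero_of_add_right_eq_neg (μ := AddCircle.haarAddCircle)
    (fourier_add_half_inv_index hk one_pos)

theorem monomial_update (n : ℕ+) (ζ : ℕ → ℂ) (j : ℕ) (z : ℂ) :
    monomial n (Function.update ζ j z)
      = z ^ expo n j * monomial n (Function.update ζ j 1) := by
  have h1 : (n : ℕ) ≤ n + j + 1 := by omega
  have hj : j ∈ Finset.range (n + j + 1) := Finset.mem_range.2 (by omega)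
  rw [monomial_eq_prod_range h1, monomial_eq_prod_range h1, ← Finset.mul_prod_erase _ _ hj,
    ← Finset.mul_prod_erase _ (fun i => Function.update ζ j 1 i ^ expo n i) hj]
  simp only [Function.update_self, one_pow, one_mul]
  congr 1
  refine Finset.prod_congr rfl fun i hi => ?_
  rw [Function.update_of_ne (Finset.ne_of_mem_erase hi),
    Function.update_of_ne (Finset.ne_of_mem_erase hi)]

theorem circlePoint_update (t : Torus) (j : ℕ) (v : UnitAddCircle) :
    (fun i => circlePoint (Function.update t j v i))
      = Function.update (fun i => circlePoint (t i)) j (circlePoint v) := by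
  ext i
  rcases eq_or_ne i j with rfl | h <;> simp [*]

theorem continuous_monomial_conj (n m : ℕ+) :
    Continuous fun t : Torus => monomial n (fun j => circlePoint (t j)) *
      (starRingEnd ℂ) (monomial m fun j => circlePoint (t j)) :=
  (continuous_monomial_circlePoint n).mul
    (Complex.continuous_conj.comp (continuous_monomial_circlePoint m))

theorem integral_monomial_conj (n m : ℕ+) :
    ∫ t, monomial n (fun j => circlePoint (t j)) *
      (starRingEnd ℂ) (monomial m fun j => circlePoint (t j)) ∂torusMeasure
      = if n = m then 1 else 0 := by
  split_ifs with h
  · subst h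
    have : ∀ t : Torus, monomial n (fun j => circlePoint (t j)) *
        (starRingEnd ℂ) (monomial n fun j => circlePoint (t j)) = 1 := by
      intro t
      rw [Complex.mul_conj, Complex.normSq_eq_norm_sq, norm_monomial_circlePoint]
      simp
    simp [this]
  · obtain ⟨j, hj⟩ : ∃ j, expo n j ≠ expo m j := by
      by_contra hcon
      push Not at hcon
      exact h (expo_ext hcon)
    rw [integral_torus_update (continuous_monomial_conj n m) j]
    refine integral_eq_zero_of_ae (Filter.Eventually.of_forall fun t => ?_)
    simp only [circlePoint_update, Pi.zero_apply]
    set ζ : ℕ → ℂ := fun i => circlePoint (t i)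
    have e : ∀ v : UnitAddCircle, monomial n (Function.update ζ j (circlePoint v)) *
        (starRingEnd ℂ) (monomial m (Function.update ζ j (circlePoint v)))
        = (monomial n (Function.update ζ j 1) *
          (starRingEnd ℂ) (monomial m (Function.update ζ j 1))) *
          (circlePoint v ^ expo n j * (starRingEnd ℂ) (circlePoint v) ^ expo m j) := by
      intro v
      rw [monomial_update, monomial_update m, map_mul, map_pow]
      ring
    simp_rw [e]
    rw [integral_const_mul, integral_circlePoint_pow_conj hj, mul_zero]

/-- Fourier coefficients of an absolutely convergent series of monomials on the torus. -/
theorem integral_tsum_monomial_conj {c : ℕ+ → ℂ} (hc : Summable fun n => ‖c n‖) (m : ℕ+) :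
    ∫ t, (∑' n, c n * monomial n fun j => circlePoint (t j)) *
      (starRingEnd ℂ) (monomial m fun j => circlePoint (t j)) ∂torusMeasure = c m := by
  have h := hasSum_integral_of_summable_integral_norm (μ := torusMeasure)
    (F := fun n t => c n * (monomial n (fun j => circlePoint (t j)) *
      (starRingEnd ℂ) (monomial m fun j => circlePoint (t j))))
    (fun n => (integrable_torus (continuous_monomial_conj n m)).const_mul _)
    (by simpa [norm_monomial_circlePoint] using hc)
  simp_rw [integral_const_mul, integral_monomial_conj] at h
  have h2 : HasSum (fun n : ℕ+ => c n * if n = m then (1 : ℂ) else 0) (c m) := by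
    convert hasSum_single m _ using 1
    · simp
    · intro n hn; simp [hn]
  rw [h2.unique h]
  refine integral_congr_ae (Filter.Eventually.of_forall fun t => ?_)
  simp only [← mul_assoc]
  rw [tsum_mul_right]

theorem continuous_tsum_monomial {c : ℕ+ → ℂ} (hc : Summable fun n => ‖c n‖) :
    Continuous fun t : Torus => ∑' n, c n * monomial n fun j => circlePoint (t j) :=
  continuous_tsum (fun n => continuous_const.mul (continuous_monomial_circlePoint n)) hc
    fun n t => by rw [norm_mul, norm_monomial_circlePoint, mul_one]

/-- Parseval's identity for an absolutely convergent series of monomials on the torus. -/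
theorem lintegral_sq_tsum_monomial {c : ℕ+ → ℂ} (hc : Summable fun n => ‖c n‖) :
    ∫⁻ t, ‖∑' n, c n * monomial n fun j => circlePoint (t j)‖ₑ ^ (2 : ℝ) ∂torusMeasure
      = ∑' n, ‖c n‖ₑ ^ 2 := by
  set g : Torus → ℂ := fun t => ∑' n, c n * monomial n fun j => circlePoint (t j) with hg
  have hgc : Continuous g := continuous_tsum_monomial hc
  have h := hasSum_integral_of_summable_integral_norm (μ := torusMeasure)
    (F := fun n t => (starRingEnd ℂ) (c n) * (g t *
      (starRingEnd ℂ) (monomial n fun j => circlePoint (t j))))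
    (fun n => (integrable_torus (hgc.mul
      (Complex.continuous_conj.comp (continuous_monomial_circlePoint n)))).const_mul _)
    (by
      have : ∀ n : ℕ+, ∫ t, ‖(starRingEnd ℂ) (c n) * (g t *
          (starRingEnd ℂ) (monomial n fun j => circlePoint (t j)))‖ ∂torusMeasure
          = ‖c n‖ * ∫ t, ‖g t‖ ∂torusMeasure := by
        intro n
        simp [norm_monomial_circlePoint, integral_const_mul]
      simp_rw [this]
      exact hc.mul_right _)
  simp_rw [integral_const_mul] at h
  simp only [hg, integral_tsum_monomial_conj hc] at h
  have h3 : ∫ t, ∑' n, (starRingEnd ℂ) (c n) * (g t *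
      (starRingEnd ℂ) (monomial n fun j => circlePoint (t j))) ∂torusMeasure
      = ((∫ t, ‖g t‖ ^ 2 ∂torusMeasure : ℝ) : ℂ) := by
    rw [← integral_complex_ofReal]
    refine integral_congr_ae (Filter.Eventually.of_forall fun t => ?_)
    have e : ∀ n, (starRingEnd ℂ) (c n) * (g t *
        (starRingEnd ℂ) (monomial n fun j => circlePoint (t j)))
        = g t * (starRingEnd ℂ) (c n * monomial n fun j => circlePoint (t j)) := by
      intro n; rw [map_mul]; ring
    simp only [e]
    rw [tsum_mul_left, ← Complex.conj_tsum]
    change g t * (starRingEnd ℂ) (g t) = _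
    rw [Complex.mul_conj, Complex.normSq_eq_norm_sq]
  have h4 : HasSum (fun n => ‖c n‖ ^ 2) (∫ t, ‖g t‖ ^ 2 ∂torusMeasure) := by
    have e : (fun n => ((‖c n‖ ^ 2 : ℝ) : ℂ)) = fun n => (starRingEnd ℂ) (c n) * c n := by
      funext n
      rw [Complex.conj_mul']
      push_cast
      rfl
    rw [← Complex.hasSum_ofReal, ← h3, e]
    exact h
  have hgi : Integrable (fun t => ‖g t‖ ^ 2) torusMeasure :=
    (hgc.norm.pow 2).integrable_of_hasCompactSupport (HasCompactSupport.of_compactSpace _)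
  calc ∫⁻ t, ‖g t‖ₑ ^ (2 : ℝ) ∂torusMeasure
      = ∫⁻ t, ENNReal.ofReal (‖g t‖ ^ 2) ∂torusMeasure := by
        refine lintegral_congr fun t => ?_
        rw [ENNReal.ofReal_pow (norm_nonneg _), ofReal_norm]
        norm_cast
    _ = ENNReal.ofReal (∫ t, ‖g t‖ ^ 2 ∂torusMeasure) :=
        (ofReal_integral_eq_lintegral_ofReal hgi
          (Filter.Eventually.of_forall fun t => by positivity)).symm
    _ = ∑' n, ENNReal.ofReal (‖c n‖ ^ 2) := by
        rw [← h4.tsum_eq, ENNReal.ofReal_tsum_of_nonneg (fun n => by positivity) h4.summable]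
    _ = _ := by
        refine tsum_congr fun n => ?_
        rw [ENNReal.ofReal_pow (norm_nonneg _), ofReal_norm]

/-! ### Cauchy coefficients and the expansion at finitely supported points -/

/-- The `e`-th Fourier coefficient of `t ↦ g (x e^{2πit})` is `x ^ e` times a Taylor coefficient of
`g`. It is allowed that `x = 0`. -/
theorem integral_circlePoint_taylor {g : ℂ → ℂ} (hg : DifferentiableOn ℂ g (Metric.ball 0 1))
    {x : ℂ} (hx : ‖x‖ < 1) (e : ℕ) :
    ∫ v, g (x * circlePoint v) * (starRingEnd ℂ) (circlePoint v) ^ e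
      ∂(AddCircle.haarAddCircle : Measure UnitAddCircle)
      = x ^ e * ((e.factorial : ℂ)⁻¹ * iteratedDeriv e g 0) := by
  set d : ℕ → ℂ := fun k => x ^ k * ((k.factorial : ℂ)⁻¹ * iteratedDeriv k g 0) with hd
  have htaylor : ∀ u : ℂ, ‖u‖ = 1 → HasSum (fun k => d k * u ^ k) (g (x * u)) := by
    intro u hu
    have := Complex.hasSum_taylorSeries_on_ball hg (z := x * u) (by simpa [hu] using hx)
    have e : (fun k => d k * u ^ k) = fun k : ℕ =>
        (k.factorial : ℂ)⁻¹ • (x * u - 0) ^ k • iteratedDeriv k g 0 := by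
      funext k
      simp only [hd, sub_zero, smul_eq_mul, mul_pow]
      ring
    rw [e]
    exact this
  have hsum : Summable fun k => ‖d k‖ := by
    have h1 := (htaylor 1 norm_one).summable.norm
    simp only [one_pow, mul_one] at h1
    exact h1
  have h := hasSum_integral_of_summable_integral_norm
    (μ := (AddCircle.haarAddCircle : Measure UnitAddCircle))
    (F := fun k v => d k * (circlePoint v ^ k * (starRingEnd ℂ) (circlePoint v) ^ e))
    (fun k => ((Continuous.mul (continuous_circlePoint.pow k)
      ((Complex.continuous_conj.comp continuous_circlePoint).pow e)).integrable_of_hasCompactSupport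
        (HasCompactSupport.of_compactSpace _)).const_mul _)
    (by simpa [norm_circlePoint] using hsum)
  have hterm : ∀ k, ∫ v, d k * (circlePoint v ^ k * (starRingEnd ℂ) (circlePoint v) ^ e)
      ∂(AddCircle.haarAddCircle : Measure UnitAddCircle) = if k = e then d k else 0 := by
    intro k
    rw [integral_const_mul]
    split_ifs with hk
    · subst hk
      have : ∀ v : UnitAddCircle,
          circlePoint v ^ k * (starRingEnd ℂ) (circlePoint v) ^ k = 1 := by
        intro v
        rw [← mul_pow, Complex.mul_conj, Complex.normSq_eq_norm_sq, norm_circlePoint]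
        simp
      simp [this]
    · rw [integral_circlePoint_pow_conj hk, mul_zero]
  simp_rw [hterm] at h
  have h2 : HasSum (fun k => if k = e then d k else 0) (d e) := by
    convert hasSum_single e _ using 1
    · simp
    · intro k hk; simp [hk]
  change _ = d e
  rw [h2.unique h]
  refine integral_congr_ae (Filter.Eventually.of_forall fun v => ?_)
  simp only [← mul_assoc]
  rw [tsum_mul_right, (htaylor _ (norm_circlePoint v)).tsum_eq]

/-- Cauchy's integral formula on the circle of radius `|ρ|`. -/
theorem integral_circlePoint_cauchy {g : ℂ → ℂ} (hg : DifferentiableOn ℂ g (Metric.ball 0 1))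
    {z ρ : ℂ} (hz : ‖z‖ < ‖ρ‖) (hρ : ‖ρ‖ < 1) :
    ∫ v, g (ρ * circlePoint v) * (1 - z / (ρ * circlePoint v))⁻¹
      ∂(AddCircle.haarAddCircle : Measure UnitAddCircle) = g z := by
  have hρ0 : ρ ≠ 0 := norm_pos_iff.1 ((norm_nonneg z).trans_lt hz)
  have hdiff : DifferentiableOn ℂ (fun u => g (ρ * u)) {u | ρ * u ∈ Metric.ball (0 : ℂ) 1} :=
    hg.comp (by fun_prop) fun u hu => hu
  have hcl : DiffContOnCl ℂ (fun u => g (ρ * u)) (Metric.ball 0 |1|) := by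
    rw [abs_one]
    refine hdiff.diffContOnCl_ball fun u hu => ?_
    have hu1 : ‖u‖ ≤ 1 := by simpa using hu
    simp only [mem_ofPred_eq, mem_ball_zero_iff, norm_mul]
    nlinarith [norm_nonneg ρ, norm_nonneg u]
  have hw : z / ρ ∈ Metric.ball (0 : ℂ) |1| := by
    rw [abs_one, mem_ball_zero_iff, norm_div, div_lt_one (norm_pos_iff.2 hρ0)]
    exact hz
  have h := DiffContOnCl.circleAverage_smul_div hcl hw
  rw [← integral_circlePoint] at h
  rw [mul_div_cancel₀ _ hρ0] at h
  rw [← h]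
  refine integral_congr_ae (Filter.Eventually.of_forall fun v => ?_)
  have hv := circlePoint_ne_zero v
  have hne : circlePoint v - z / ρ ≠ 0 := by
    intro h0
    have : ‖circlePoint v‖ = ‖z / ρ‖ := by rw [sub_eq_zero.1 h0]
    rw [norm_circlePoint] at this
    simp only [abs_one, mem_ball_zero_iff] at hw
    linarith
  have e : 1 - z / (ρ * circlePoint v) = (circlePoint v - z / ρ) / circlePoint v := by
    field_simp
  simp only [e, sub_zero, smul_eq_mul, inv_div]
  ring

/-- The point `(ρ_j e^{2πi t_j})_j`. -/
def torusPoint (ρ : Ell1) (t : Torus) : Ell1 :=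
  ell1Of (fun j => ρ j * circlePoint (t j))
    (by simpa [norm_circlePoint] using (ell1_hasSum_norm ρ).summable)

@[simp] theorem torusPoint_apply (ρ : Ell1) (t : Torus) (j : ℕ) :
    torusPoint ρ t j = ρ j * circlePoint (t j) := rfl

theorem torusPoint_mem {ρ : Ell1} (h : ρ ∈ polydisk) (t : Torus) : torusPoint ρ t ∈ polydisk := by
  intro j
  simpa [norm_circlePoint] using h j

theorem continuous_torusPoint (ρ : Ell1) : Continuous (torusPoint ρ) :=
  continuous_ell1Of (ell1_hasSum_norm ρ).summable
    (fun j => continuous_const.mul (continuous_circlePoint.comp (continuous_apply j)))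
    (fun t j => by simp [norm_circlePoint]) _

/-- The point with coordinates `ρ_j e^{2πi t_j}` for `j ∈ S` and `ζ_j` for `j ∉ S`. -/
def mixedPoint (ζ ρ : Ell1) (S : Finset ℕ) (t : Torus) : Ell1 :=
  ell1Of (fun j => if j ∈ S then ρ j * circlePoint (t j) else ζ j)
    (by
      refine Summable.of_nonneg_of_le (fun j => norm_nonneg _) (fun j => ?_)
        ((ell1_hasSum_norm ρ).summable.add (ell1_hasSum_norm ζ).summable)
      split_ifs <;> simp [norm_circlePoint])

theorem mixedPoint_apply (ζ ρ : Ell1) (S : Finset ℕ) (t : Torus) (j : ℕ) :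
    mixedPoint ζ ρ S t j = if j ∈ S then ρ j * circlePoint (t j) else ζ j := rfl

theorem mixedPoint_mem {ζ ρ : Ell1} (hζ : ζ ∈ polydisk) {S : Finset ℕ} (hρ : ∀ j ∈ S, ‖ρ j‖ < 1)
    (t : Torus) : mixedPoint ζ ρ S t ∈ polydisk := by
  intro j
  rw [mixedPoint_apply]
  split_ifs with h
  · simpa [norm_circlePoint] using hρ j h
  · exact hζ j

theorem continuous_mixedPoint (ζ ρ : Ell1) (S : Finset ℕ) : Continuous (mixedPoint ζ ρ S) := by
  refine continuous_ell1Of ((ell1_hasSum_norm ρ).summable.add (ell1_hasSum_norm ζ).summable)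
    (fun j => ?_) (fun t j => ?_) _
  · by_cases h : j ∈ S
    · simp only [h, if_true]
      exact continuous_const.mul (continuous_circlePoint.comp (continuous_apply j))
    · simpa [h] using continuous_const
  · split_ifs <;> simp [norm_circlePoint]

/-- The normalized Fourier coefficient
`(ρ^{α(n)})⁻¹ ∫ F(ρ₁w₁, ρ₂w₂, ...) conj(w^{α(n)}) dm_∞(w)`. -/
def cauchyCoeff (F : Ell1 → ℂ) (n : ℕ+) (ρ : Ell1) : ℂ :=
  (monomial n ρ)⁻¹ * ∫ t, F (torusPoint ρ t) *
    (starRingEnd ℂ) (monomial n fun j => circlePoint (t j)) ∂torusMeasure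

theorem norm_cauchyCoeff_le {F : Ell1 → ℂ} {n : ℕ+} {ρ : Ell1} {C : ℝ}
    (hC : ∀ t, ‖F (torusPoint ρ t)‖ ≤ C) : ‖cauchyCoeff F n ρ‖ ≤ ‖monomial n ρ‖⁻¹ * C := by
  rw [cauchyCoeff, norm_mul, norm_inv]
  gcongr
  refine (norm_integral_le_of_norm_le_const (C := C)
    (Filter.Eventually.of_forall fun t => ?_)).trans (by simp)
  rw [norm_mul, RCLike.norm_conj, norm_monomial_circlePoint, mul_one]
  exact hC t

theorem coe_setCoord (ξ : Ell1) (j : ℕ) (z : ℂ) :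
    (setCoord ξ j z : ℕ → ℂ) = Function.update ξ j z := by
  ext i
  rw [setCoord_apply, Function.update_apply]

theorem torusPoint_setCoord_update (ρ : Ell1) (j : ℕ) (x : ℂ) (t : Torus) (v : UnitAddCircle) :
    torusPoint (setCoord ρ j x) (Function.update t j v)
      = setCoord (torusPoint ρ t) j (x * circlePoint v) := by
  ext i
  simp only [torusPoint_apply, setCoord_apply]
  split_ifs with h
  · subst h; simp
  · simp [h]

theorem setCoord_mem {ξ : Ell1} (hξ : ξ ∈ polydisk) (j : ℕ) {z : ℂ} (hz : ‖z‖ < 1) :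
    setCoord ξ j z ∈ polydisk := by
  intro i
  rw [setCoord_apply]
  split_ifs
  · exact hz
  · exact hξ i

theorem IsAnalyticOnPolydisk.continuous_torusPoint {F : Ell1 → ℂ} (hF : IsAnalyticOnPolydisk F)
    {ρ : Ell1} (hρ : ρ ∈ polydisk) : Continuous fun t => F (torusPoint ρ t) :=
  hF.continuousOn.comp_continuous (InfHardy.continuous_torusPoint ρ) (torusPoint_mem hρ)

theorem cauchyCoeff_setCoord {F : Ell1 → ℂ} (hF : IsAnalyticOnPolydisk F) {n : ℕ+} {ρ : Ell1}
    (hρ : ρ ∈ polydisk) (j : ℕ) {x : ℂ} (hx : ‖x‖ < 1) (hx0 : expo n j ≠ 0 → x ≠ 0) :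
    cauchyCoeff F n (setCoord ρ j x) = (monomial n (Function.update ρ j 1))⁻¹ *
      ∫ t, ((expo n j).factorial : ℂ)⁻¹ *
        iteratedDeriv (expo n j) (fun z => F (setCoord (torusPoint ρ t) j z)) 0 *
        (starRingEnd ℂ) (monomial n (Function.update (fun i => circlePoint (t i)) j 1))
        ∂torusMeasure := by
  have hxe : x ^ expo n j ≠ 0 := by
    by_cases h : expo n j = 0
    · simp [h]
    · exact pow_ne_zero _ (hx0 h)
  have hcont : Continuous fun t : Torus => F (torusPoint (setCoord ρ j x) t) *
      (starRingEnd ℂ) (monomial n fun j => circlePoint (t j)) :=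
    (hF.continuous_torusPoint (setCoord_mem hρ j hx)).mul
      (Complex.continuous_conj.comp (continuous_monomial_circlePoint n))
  rw [cauchyCoeff, integral_torus_update hcont j, coe_setCoord, monomial_update, mul_inv]
  have key : ∀ t : Torus, ∫ v, F (torusPoint (setCoord ρ j x) (Function.update t j v)) *
      (starRingEnd ℂ) (monomial n fun i => circlePoint (Function.update t j v i))
        ∂AddCircle.haarAddCircle
      = x ^ expo n j * (((expo n j).factorial : ℂ)⁻¹ *
        iteratedDeriv (expo n j) (fun z => F (setCoord (torusPoint ρ t) j z)) 0 *
        (starRingEnd ℂ) (monomial n (Function.update (fun i => circlePoint (t i)) j 1))) := by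
    intro t
    have h := integral_circlePoint_taylor
      (hF.differentiableOn_setCoord (torusPoint_mem hρ t) j) hx (expo n j)
    rw [← mul_assoc, ← h, ← integral_mul_const]
    refine integral_congr_ae (Filter.Eventually.of_forall fun v => ?_)
    simp only [torusPoint_setCoord_update]
    rw [circlePoint_update, monomial_update, map_mul, map_pow]
    ring
  simp_rw [key]
  rw [integral_const_mul]
  field_simp

theorem setCoord_self (ρ : Ell1) (j : ℕ) : setCoord ρ j (ρ j) = ρ := by
  ext i
  rw [setCoord_apply]
  split_ifs with h
  · rw [h]
  · rfl

/-- The normalized Fourier coefficient does not depend on the radii, as long as only finitely many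
of them are changed and the radii that occur in `ρ^{α(n)}` do not vanish. -/
theorem cauchyCoeff_eq {F : Ell1 → ℂ} (hF : IsAnalyticOnPolydisk F) {n : ℕ+} (S : Finset ℕ) :
    ∀ {ρ ρ' : Ell1}, ρ ∈ polydisk → ρ' ∈ polydisk → (∀ j, expo n j ≠ 0 → ρ j ≠ 0) →
      (∀ j, expo n j ≠ 0 → ρ' j ≠ 0) → (∀ j, j ∉ S → ρ j = ρ' j) →
      cauchyCoeff F n ρ = cauchyCoeff F n ρ' := by
  induction S using Finset.induction_on with
  | empty =>
    intro ρ ρ' _ _ _ _ h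
    rw [show ρ = ρ' from lp.ext (funext fun j => h j (by simp))]
  | insert j S hj ih =>
    intro ρ ρ' hρ hρ' h0 h0' h
    have h1 : cauchyCoeff F n ρ = cauchyCoeff F n (setCoord ρ j (ρ' j)) := by
      conv_lhs => rw [← setCoord_self ρ j]
      rw [cauchyCoeff_setCoord hF hρ j (hρ j) (h0 j), cauchyCoeff_setCoord hF hρ j (hρ' j) (h0' j)]
    rw [h1]
    refine ih (setCoord_mem hρ j (hρ' j)) hρ' (fun i hi => ?_) h0' fun i hi => ?_
    · rw [setCoord_apply]
      split_ifs with hij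
      · exact hij ▸ h0' i hi
      · exact h0 i hi
    · rw [setCoord_apply]
      split_ifs with hij
      · rw [hij]
      · exact h i (by simp [hij, hi])

/-- Cauchy's integral formula in finitely many variables. -/
theorem integral_mixedPoint_cauchy {F : Ell1 → ℂ} (hF : IsAnalyticOnPolydisk F) {ζ ρ : Ell1}
    (hζ : ζ ∈ polydisk) (S : Finset ℕ) (h1 : ∀ j ∈ S, ‖ρ j‖ < 1) (h2 : ∀ j ∈ S, ‖ζ j‖ < ‖ρ j‖) :
    ∫ t, F (mixedPoint ζ ρ S t) * ∏ j ∈ S, (1 - ζ j / (ρ j * circlePoint (t j)))⁻¹ ∂torusMeasure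
      = F ζ := by
  induction S using Finset.induction_on with
  | empty =>
    have : ∀ t, mixedPoint ζ ρ ∅ t = ζ := fun t => by
      ext j; simp [mixedPoint_apply]
    simp [this]
  | insert j S hj ih =>
    have hjS : ‖ρ j‖ < 1 ∧ ‖ζ j‖ < ‖ρ j‖ := ⟨h1 j (by simp), h2 j (by simp)⟩
    rw [← ih (fun i hi => h1 i (by simp [hi])) (fun i hi => h2 i (by simp [hi]))]
    have hcont : Continuous fun t : Torus => F (mixedPoint ζ ρ (insert j S) t) *
        ∏ i ∈ insert j S, (1 - ζ i / (ρ i * circlePoint (t i)))⁻¹ := by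
      refine (hF.continuousOn.comp_continuous (continuous_mixedPoint ζ ρ _)
        (mixedPoint_mem hζ h1)).mul (continuous_finsetProd _ fun i hi => ?_)
      have hi0 : ρ i ≠ 0 := norm_pos_iff.1 ((norm_nonneg _).trans_lt (h2 i hi))
      refine Continuous.inv₀ (continuous_const.sub (continuous_const.div
        (continuous_const.mul (continuous_circlePoint.comp (continuous_apply i)))
        fun t => mul_ne_zero hi0 (circlePoint_ne_zero _))) fun t h0 => ?_
      have : ‖ζ i / (ρ i * circlePoint (t i))‖ = 1 := by
        rw [← sub_eq_zero.1 h0, norm_one]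
      rw [norm_div, norm_mul, norm_circlePoint, mul_one,
        div_eq_one_iff_eq (norm_ne_zero_iff.2 hi0)] at this
      exact (h2 i hi).ne this
    rw [integral_torus_update hcont j]
    refine integral_congr_ae (Filter.Eventually.of_forall fun t => ?_)
    have hmix : ∀ v, mixedPoint ζ ρ (insert j S) (Function.update t j v)
        = setCoord (mixedPoint ζ ρ S t) j (ρ j * circlePoint v) := by
      intro v
      ext i
      rw [setCoord_apply, mixedPoint_apply, mixedPoint_apply]
      by_cases hij : i = j
      · subst hij; simp
      · simp [hij]
    have hself : setCoord (mixedPoint ζ ρ S t) j (ζ j) = mixedPoint ζ ρ S t := by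
      conv_rhs => rw [← setCoord_self (mixedPoint ζ ρ S t) j]
      rw [mixedPoint_apply, if_neg hj]
    have hprod : ∀ v, ∏ i ∈ S, (1 - ζ i / (ρ i * circlePoint (Function.update t j v i)))⁻¹
        = ∏ i ∈ S, (1 - ζ i / (ρ i * circlePoint (t i)))⁻¹ := by
      intro v
      refine Finset.prod_congr rfl fun i hi => ?_
      have hij : i ≠ j := fun h => hj (h ▸ hi)
      rw [Function.update_of_ne hij]
    have h := integral_circlePoint_cauchy (hF.differentiableOn_setCoord
      (mixedPoint_mem hζ (S := S) (fun i hi => h1 i (by simp [hi])) t) j) hjS.2 hjS.1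
    simp only [hself] at h
    beta_reduce
    rw [← h, ← integral_mul_const]
    refine integral_congr_ae (Filter.Eventually.of_forall fun v => ?_)
    simp only [hmix, Finset.prod_insert hj, hprod, Function.update_self]
    ring

/-- The radii `(1/2, ..., 1/2, 0, 0, ...)` with `n` nonzero entries. -/
def baseRadius (n : ℕ) : Ell1 :=
  ell1Of (fun j => if j < n then 1 / 2 else 0)
    (summable_of_hasFiniteSupport ((Set.finite_Iio n).subset fun j hj => by
      by_contra h
      simp only [mem_Iio] at h
      simp [h] at hj))

theorem baseRadius_apply (n j : ℕ) : baseRadius n j = if j < n then 1 / 2 else 0 := rfl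

theorem baseRadius_mem (n : ℕ) : baseRadius n ∈ polydisk := by
  intro j
  rw [baseRadius_apply]
  split_ifs <;> norm_num

/-- The coefficient of `ζ^{α(n)}` in the monomial expansion of `F`, as a Cauchy integral. -/
def taylorCoeff (F : Ell1 → ℂ) (n : ℕ+) : ℂ := cauchyCoeff F n (baseRadius n)

theorem cauchyCoeff_eq_taylorCoeff {F : Ell1 → ℂ} (hF : IsAnalyticOnPolydisk F) {n : ℕ+}
    {ρ : Ell1} (hρ : ρ ∈ polydisk) {s : ℕ} (hs : ∀ j, s ≤ j → ρ j = 0)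
    (h0 : ∀ j, expo n j ≠ 0 → ρ j ≠ 0) : cauchyCoeff F n ρ = taylorCoeff F n := by
  refine cauchyCoeff_eq hF (Finset.range (s + n)) hρ (baseRadius_mem n) h0 (fun j hj => ?_)
    fun j hj => ?_
  · rw [baseRadius_apply, if_pos]
    · norm_num
    · by_contra h
      exact hj (expo_eq_zero_of_le (not_lt.1 h))
  · simp only [Finset.mem_range, not_lt] at hj
    rw [hs j (by omega), baseRadius_apply, if_neg (by omega)]

theorem monomial_inv (n : ℕ+) (ζ : ℕ → ℂ) :
    monomial n (fun j => (ζ j)⁻¹) = (monomial n ζ)⁻¹ := by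
  simp [monomial]

/-- Expanding the Cauchy kernel gives the monomial expansion at finitely supported points. -/
theorem hasSum_taylorCoeff_of_finite {F : Ell1 → ℂ} (hF : IsAnalyticOnPolydisk F) {ζ : Ell1}
    (hζ : ζ ∈ polydisk) {s : ℕ} (hs : ∀ j, s ≤ j → ζ j = 0) :
    HasSum (fun n => taylorCoeff F n * monomial n ζ) (F ζ) := by
  obtain ⟨q, hq0, hq1, hq⟩ := exists_lt_one_of_mem_polydisk hζ
  set q' : ℝ := (q + 1) / 2 with hq'
  have hqq : q < q' := by rw [hq']; linarith
  have hq'1 : q' < 1 := by rw [hq']; linarith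
  have hq'0 : 0 < q' := hq0.trans hqq
  let ρ : Ell1 := ell1Of (fun j => if j < s then (q' : ℂ) else 0)
    (summable_of_hasFiniteSupport ((Set.finite_Iio s).subset fun j hj => by
      by_contra h
      simp only [mem_Iio] at h
      simp [h] at hj))
  have hρ_apply : ∀ j, ρ j = if j < s then (q' : ℂ) else 0 := fun j => rfl
  have hρlt : ∀ j, j < s → ‖ρ j‖ = q' := fun j hj => by
    rw [hρ_apply, if_pos hj, Complex.norm_real, Real.norm_of_nonneg hq'0.le]
  have hρs : ∀ j, s ≤ j → ρ j = 0 := fun j hj => by rw [hρ_apply, if_neg (by omega)]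
  have hρ : ρ ∈ polydisk := by
    intro j
    rcases lt_or_ge j s with h | h
    · rw [hρlt j h]; exact hq'1
    · rw [hρs j h]; simp
  set x : Torus → ℕ → ℂ := fun t j => ζ j * (ρ j)⁻¹ * (starRingEnd ℂ) (circlePoint (t j)) with hx
  have hxnorm : ∀ t j, ‖x t j‖ = ‖ζ j * (ρ j)⁻¹‖ := fun t j => by
    simp only [hx]
    rw [norm_mul, RCLike.norm_conj, norm_circlePoint, mul_one]
  have hlt1 : ∀ j, ‖ζ j * (ρ j)⁻¹‖ < 1 := by
    intro j
    rcases lt_or_ge j s with h | h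
    · rw [norm_mul, norm_inv, hρlt j h, ← div_eq_mul_inv, div_lt_one hq'0]
      exact (hq j).trans_lt hqq
    · rw [hs j h]; simp
  have hE : ∀ t, HasSum (fun n : ℕ+ => monomial n (x t)) (∏ j ∈ Finset.range s, (1 - x t j)⁻¹) :=
    fun t => (hasSum_monomial_of_finite (fun j => by rw [hxnorm]; exact hlt1 j)
      fun j hj => by simp only [hx]; rw [hs j hj]; simp).2
  have hsumm : Summable fun n : ℕ+ => ‖monomial n (fun j => ζ j * (ρ j)⁻¹)‖ :=
    (hasSum_monomial_of_finite hlt1 (s := s) fun j hj => by rw [hs j hj]; simp).1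
  have hmon : ∀ n t, monomial n (x t) = monomial n ζ * (monomial n ρ)⁻¹ *
      (starRingEnd ℂ) (monomial n fun j => circlePoint (t j)) := by
    intro n t
    rw [hx, monomial_mul, monomial_mul, monomial_inv]
    congr 1
    simp [monomial]
  have hcont := hF.continuous_torusPoint hρ
  have h := hasSum_integral_of_summable_integral_norm (μ := torusMeasure)
    (F := fun (n : ℕ+) t => F (torusPoint ρ t) * monomial n (x t))
    (fun n => integrable_torus (hcont.mul (by
      simp_rw [hmon]
      exact continuous_const.mul
        (Complex.continuous_conj.comp (continuous_monomial_circlePoint n)))))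
    (by
      have : ∀ n : ℕ+, ∫ t, ‖F (torusPoint ρ t) * monomial n (x t)‖ ∂torusMeasure
          = (∫ t, ‖F (torusPoint ρ t)‖ ∂torusMeasure) *
            ‖monomial n (fun j => ζ j * (ρ j)⁻¹)‖ := by
        intro n
        rw [← integral_mul_const]
        refine integral_congr_ae (Filter.Eventually.of_forall fun t => ?_)
        simp only [norm_mul, norm_monomial, hxnorm]
      simp_rw [this]
      exact hsumm.mul_left _)
  have hterm : ∀ n : ℕ+, ∫ t, F (torusPoint ρ t) * monomial n (x t) ∂torusMeasure
      = taylorCoeff F n * monomial n ζ := by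
    intro n
    have e : ∀ t, F (torusPoint ρ t) * monomial n (x t) = monomial n ζ * ((monomial n ρ)⁻¹ *
        (F (torusPoint ρ t) * (starRingEnd ℂ) (monomial n fun j => circlePoint (t j)))) := by
      intro t; rw [hmon]; ring
    simp_rw [e]
    rw [integral_const_mul, integral_const_mul]
    change monomial n ζ * cauchyCoeff F n ρ = _
    by_cases h0 : ∀ j, expo n j ≠ 0 → ρ j ≠ 0
    · rw [cauchyCoeff_eq_taylorCoeff hF hρ hρs h0, mul_comm]
    · push Not at h0
      obtain ⟨j, hj, hj0⟩ := h0
      have hjs : s ≤ j := by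
        by_contra hlt
        have := hρlt j (by omega)
        rw [hj0, norm_zero] at this
        exact hq'0.ne this
      have : monomial n ζ = 0 := by
        refine Finset.prod_eq_zero (i := j) (Finset.mem_range.2 ?_) (by rw [hs j hjs, zero_pow hj])
        by_contra hle
        exact hj (expo_eq_zero_of_le (by omega))
      rw [this]; simp
  simp_rw [hterm] at h
  have hζρ : ∀ j ∈ Finset.range s, ‖ζ j‖ < ‖ρ j‖ := fun j hj => by
    rw [hρlt j (Finset.mem_range.1 hj)]; exact (hq j).trans_lt hqq
  suffices hF' : F ζ = ∫ t, ∑' n : ℕ+, F (torusPoint ρ t) * monomial n (x t) ∂torusMeasure by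
    rw [hF']
    exact h
  rw [← integral_mixedPoint_cauchy hF hζ (ρ := ρ) (Finset.range s) (fun j _ => hρ j) hζρ]
  refine integral_congr_ae (Filter.Eventually.of_forall fun t => ?_)
  have hmix : mixedPoint ζ ρ (Finset.range s) t = torusPoint ρ t := by
    ext j
    rw [mixedPoint_apply, torusPoint_apply]
    split_ifs with hj
    · rfl
    · have hj' : s ≤ j := by simpa using hj
      rw [hs j hj', hρs j hj', zero_mul]
  simp only [hmix]
  rw [tsum_mul_left, (hE t).tsum_eq]
  congr 1
  refine Finset.prod_congr rfl fun j _ => ?_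
  simp only [hx]
  have : (starRingEnd ℂ) (circlePoint (t j)) = (circlePoint (t j))⁻¹ := by
    rw [Complex.inv_def, Complex.normSq_eq_norm_sq, norm_circlePoint]; simp
  rw [this, div_eq_mul_inv, mul_inv, mul_assoc]

/-! ### Absolute convergence of the monomial expansion -/

theorem isCompact_polydisc (ζ : Ell1) : IsCompact {κ : Ell1 | ∀ j, ‖κ j‖ ≤ ‖ζ j‖} := by
  have hs : ∀ v : ℕ → Metric.closedBall (0 : ℂ) 1,
      Summable fun j => ‖((‖ζ j‖ : ℝ) : ℂ) * (v j : ℂ)‖ := fun v => by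
    refine Summable.of_nonneg_of_le (fun j => norm_nonneg _) (fun j => ?_)
      (ell1_hasSum_norm ζ).summable
    rw [norm_mul, Complex.norm_real, norm_norm]
    exact mul_le_of_le_one_right (norm_nonneg _) (mem_closedBall_zero_iff.1 (v j).2)
  have hc : Continuous fun v => ell1Of _ (hs v) := by
    refine continuous_ell1Of (ell1_hasSum_norm ζ).summable (fun j => ?_) (fun v j => ?_) hs
    · exact continuous_const.mul (continuous_subtype_val.comp (continuous_apply j))
    · rw [norm_mul, Complex.norm_real, norm_norm]
      exact mul_le_of_le_one_right (norm_nonneg _) (mem_closedBall_zero_iff.1 (v j).2)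
  convert isCompact_range hc using 1
  ext κ
  constructor
  · intro hκ
    refine ⟨fun j => ⟨κ j / ((‖ζ j‖ : ℝ) : ℂ), ?_⟩, ?_⟩
    · rw [mem_closedBall_zero_iff, norm_div, Complex.norm_real, norm_norm]
      exact div_le_one_of_le₀ (hκ j) (norm_nonneg _)
    · ext j
      rw [ell1Of_apply]
      by_cases h : ‖ζ j‖ = 0
      · have : κ j = 0 := norm_le_zero_iff.1 (h ▸ hκ j)
        simp [this]
      · exact mul_div_cancel₀ _ (Complex.ofReal_ne_zero.2 h)
  · rintro ⟨v, rfl⟩ j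
    simp only [ell1Of_apply]
    rw [norm_mul, Complex.norm_real, norm_norm]
    exact mul_le_of_le_one_right (norm_nonneg _) (mem_closedBall_zero_iff.1 (v j).2)

/-- An analytic function is bounded on a uniform neighbourhood of a closed polydisc
`{|κ_j| ≤ |ζ_j|}`, which is compact in `ℓ¹`. -/
theorem IsAnalyticOnPolydisk.exists_uniform_bound {F : Ell1 → ℂ} (hF : IsAnalyticOnPolydisk F)
    {ζ : Ell1} (hζ : ζ ∈ polydisk) :
    ∃ ε > 0, ∃ C : ℝ, ∀ κ : Ell1, (∀ j, ‖κ j‖ ≤ ‖ζ j‖) → ∀ ξ, dist ξ κ < ε → ‖F ξ‖ ≤ C := by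
  refine (isCompact_polydisc ζ).induction_on
    (p := fun s => ∃ ε > 0, ∃ C : ℝ, ∀ κ ∈ s, ∀ ξ, dist ξ κ < ε → ‖F ξ‖ ≤ C) ?_ ?_ ?_ ?_
  · exact ⟨1, one_pos, 0, by simp⟩
  · rintro s t hst ⟨ε, hε, C, h⟩
    exact ⟨ε, hε, C, fun κ hκ => h κ (hst hκ)⟩
  · rintro s t ⟨ε, hε, C, h⟩ ⟨ε', hε', C', h'⟩
    refine ⟨min ε ε', lt_min hε hε', max C C', fun κ hκ ξ hξ => ?_⟩
    rcases hκ with hκ | hκ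
    · exact (h κ hκ ξ (hξ.trans_le (min_le_left _ _))).trans (le_max_left _ _)
    · exact (h' κ hκ ξ (hξ.trans_le (min_le_right _ _))).trans (le_max_right _ _)
  · intro κ hκ
    obtain ⟨δ, hδ, C, -, hC⟩ := hF.exists_ball_bound (ζ := κ) fun j => (hκ j).trans_lt (hζ j)
    refine ⟨Metric.ball κ (δ / 2),
      mem_nhdsWithin_of_mem_nhds (Metric.ball_mem_nhds κ (half_pos hδ)),
      δ / 2, half_pos hδ, C, fun κ' hκ' ξ hξ => hC ξ ?_⟩
    rw [Metric.mem_ball] at hκ' ⊢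
    linarith [dist_triangle ξ κ' κ]

/-- `m^m / ∏ e_j^{e_j}` exceeds the multinomial coefficient `m! / ∏ e_j!` by at most the factor
`exp m`. -/
theorem pow_sum_le_multinomial (S : Finset ℕ) (e : ℕ → ℕ) :
    ((∑ j ∈ S, e j : ℕ) : ℝ) ^ (∑ j ∈ S, e j) ≤
      Real.exp (∑ j ∈ S, e j : ℕ) * Nat.multinomial S e * ∏ j ∈ S, (e j : ℝ) ^ e j := by
  set m := ∑ j ∈ S, e j with hm
  have h1 : (m : ℝ) ^ m ≤ Real.exp m * m.factorial := by
    have := Real.pow_div_factorial_le_exp (m : ℝ) (by positivity) m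
    rwa [div_le_iff₀ (by positivity)] at this
  have h2 : (m.factorial : ℝ) = (∏ j ∈ S, ((e j).factorial : ℝ)) * Nat.multinomial S e := by
    have := Nat.multinomial_spec S e
    rw [← hm] at this
    exact_mod_cast this.symm
  have h3 : ∏ j ∈ S, ((e j).factorial : ℝ) ≤ ∏ j ∈ S, (e j : ℝ) ^ e j :=
    Finset.prod_le_prod (fun j _ => by positivity) fun j _ => by
      exact_mod_cast Nat.factorial_le_pow (e j)
  calc (m : ℝ) ^ m ≤ Real.exp m * m.factorial := h1
    _ = Real.exp m * Nat.multinomial S e * ∏ j ∈ S, ((e j).factorial : ℝ) := by rw [h2]; ring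
    _ ≤ _ := by gcongr

/-- Finite sums of geometric terms in the first `N` variables times multinomial terms in the other
variables are bounded: the first factors sum to `(1 - q)⁻ᴺ`, the second, by the multinomial
theorem, to a geometric series. -/
theorem sum_geometric_multinomial_le {q σ : ℝ} (hq0 : 0 ≤ q) (hq1 : q < 1) (hσ1 : σ < 1)
    {y : ℕ → ℝ} (hy : ∀ j, 0 ≤ y j) {N s : ℕ} (hNs : N ≤ s)
    (hσ : ∑ j ∈ Finset.Ico N s, y j ≤ σ) (T : Finset ℕ+) (hT : ∀ n ∈ T, (n : ℕ) ≤ s) :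
    ∑ n ∈ T, (∏ j ∈ Finset.range N, q ^ expo n j) *
      (Nat.multinomial (Finset.Ico N s) (expo n) * ∏ j ∈ Finset.Ico N s, y j ^ expo n j)
      ≤ ((1 - q)⁻¹) ^ N * (1 - σ)⁻¹ := by
  classical
  have hσ0 : 0 ≤ ∑ j ∈ Finset.Ico N s, y j := Finset.sum_nonneg fun j _ => hy j
  set L : ℕ := T.sup fun n => ∑ j ∈ Finset.range s, expo n j with hL
  set A : Finset (Fin N → ℕ) := Fintype.piFinset fun _ => Finset.range (L + 1) with hA
  set B : Finset (Σ _ : ℕ, ℕ → ℕ) :=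
    (Finset.range (L + 1)).sigma fun m => Finset.piAntidiag (Finset.Ico N s) m with hB
  let f : (Fin N → ℕ) × (Σ _ : ℕ, ℕ → ℕ) → ℝ := fun p => (∏ i, q ^ p.1 i) *
    (Nat.multinomial (Finset.Ico N s) p.2.2 * ∏ j ∈ Finset.Ico N s, y j ^ p.2.2 j)
  have hf : ∀ p, 0 ≤ f p := fun p => mul_nonneg (Finset.prod_nonneg fun i _ => pow_nonneg hq0 _)
    (mul_nonneg (Nat.cast_nonneg _) (Finset.prod_nonneg fun j _ => pow_nonneg (hy j) _))
  let tail : ℕ+ → ℕ → ℕ := fun n j => if j ∈ Finset.Ico N s then expo n j else 0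
  let Φ : ℕ+ → (Fin N → ℕ) × (Σ _ : ℕ, ℕ → ℕ) := fun n =>
    (fun i => expo n i, ⟨∑ j ∈ Finset.Ico N s, expo n j, tail n⟩)
  have htail : ∀ n, ∀ j ∈ Finset.Ico N s, tail n j = expo n j := fun n j hj => if_pos hj
  have hΦf : ∀ n, f (Φ n) = (∏ j ∈ Finset.range N, q ^ expo n j) *
      (Nat.multinomial (Finset.Ico N s) (expo n) * ∏ j ∈ Finset.Ico N s, y j ^ expo n j) := by
    intro n
    simp only [f, Φ]
    rw [← Fin.prod_univ_eq_prod_range (fun j => q ^ expo n j) N,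
      Nat.multinomial_congr (htail n)]
    congr 2
    exact Finset.prod_congr rfl fun j hj => by rw [htail n j hj]
  have hinj : Set.InjOn Φ T := by
    intro n hn n' hn' h
    refine expo_ext fun j => ?_
    simp only [Φ, Prod.mk.injEq, Sigma.mk.injEq, heq_eq_eq] at h
    obtain ⟨h1, -, h3⟩ := h
    rcases lt_or_ge j N with hj | hj
    · exact congrFun h1 ⟨j, hj⟩
    · rcases lt_or_ge j s with hj' | hj'
      · have hmem : j ∈ Finset.Ico N s := Finset.mem_Ico.2 ⟨hj, hj'⟩
        rw [← htail n j hmem, ← htail n' j hmem, h3]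
      · rw [expo_eq_zero_of_le ((hT n hn).trans hj'), expo_eq_zero_of_le ((hT n' hn').trans hj')]
  have hmaps : T.image Φ ⊆ A ×ˢ B := by
    intro p hp
    obtain ⟨n, hn, rfl⟩ := Finset.mem_image.1 hp
    have hnL : ∑ j ∈ Finset.range s, expo n j ≤ L :=
      Finset.le_sup (f := fun n => ∑ j ∈ Finset.range s, expo n j) hn
    refine Finset.mem_product.2 ⟨Fintype.mem_piFinset.2 fun i => ?_,
      Finset.mem_sigma.2 ⟨?_, Finset.mem_piAntidiag.2 ⟨?_, ?_⟩⟩⟩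
    · have : expo n i ≤ ∑ j ∈ Finset.range s, expo n j :=
        Finset.single_le_sum (fun _ _ => Nat.zero_le _)
          (Finset.mem_range.2 (i.2.trans_le hNs))
      exact Finset.mem_range.2 (by simp only [Φ]; omega)
    · have : ∑ j ∈ Finset.Ico N s, expo n j ≤ ∑ j ∈ Finset.range s, expo n j :=
        Finset.sum_le_sum_of_subset fun j hj =>
          Finset.mem_range.2 (Finset.mem_Ico.1 hj).2
      exact Finset.mem_range.2 (by simp only [Φ]; omega)
    · exact Finset.sum_congr rfl (htail n)
    · intro j hj
      by_contra hcon
      exact hj (if_neg hcon)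
  calc _ = ∑ n ∈ T, f (Φ n) := Finset.sum_congr rfl fun n _ => (hΦf n).symm
    _ = ∑ p ∈ T.image Φ, f p := (Finset.sum_image hinj).symm
    _ ≤ ∑ p ∈ A ×ˢ B, f p := Finset.sum_le_sum_of_subset_of_nonneg hmaps fun p _ _ => hf p
    _ = (∑ k ∈ A, ∏ i, q ^ k i) * ∑ b ∈ B, (Nat.multinomial (Finset.Ico N s) b.2 *
          ∏ j ∈ Finset.Ico N s, y j ^ b.2 j : ℝ) := by
        rw [Finset.sum_mul_sum, ← Finset.sum_product']
    _ = (∑ k ∈ Finset.range (L + 1), q ^ k) ^ N *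
          ∑ m ∈ Finset.range (L + 1), (∑ j ∈ Finset.Ico N s, y j) ^ m := by
        congr 1
        · rw [hA, ← Finset.prod_univ_sum]
          simp
        · rw [hB, Finset.sum_sigma]
          exact Finset.sum_congr rfl fun m _ => (Finset.sum_pow_eq_sum_piAntidiag _ _ _).symm
    _ ≤ ((1 - q)⁻¹) ^ N * (1 - σ)⁻¹ := by
        have hgeo : ∀ {a : ℝ}, 0 ≤ a → a < 1 → ∑ k ∈ Finset.range (L + 1), a ^ k ≤ (1 - a)⁻¹ := by
          intro a h0 h1
          rw [← tsum_geometric_of_lt_one h0 h1]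
          exact (summable_geometric_of_lt_one h0 h1).sum_le_tsum _ fun k _ => pow_nonneg h0 k
        have hnn : 0 ≤ ∑ k ∈ Finset.range (L + 1), q ^ k :=
          Finset.sum_nonneg fun k _ => pow_nonneg hq0 k
        have h1q : (0 : ℝ) ≤ (1 - q)⁻¹ := inv_nonneg.2 (by linarith)
        refine mul_le_mul (pow_le_pow_left₀ hnn (hgeo hq0 hq1) N) ?_
          (Finset.sum_nonneg fun k _ => pow_nonneg hσ0 k) (pow_nonneg h1q _)
        refine (hgeo hσ0 (hσ.trans_lt hσ1)).trans ?_
        exact inv_anti₀ (by linarith) (by linarith)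

theorem realMonomial_eq_prod {n : ℕ+} {s N : ℕ} (hNs : N ≤ s) (h : (n : ℕ) ≤ s) (x : ℕ → ℝ) :
    realMonomial n x = (∏ j ∈ Finset.range N, x j ^ expo n j) *
      ∏ j ∈ Finset.Ico N s, x j ^ expo n j := by
  rw [Finset.prod_range_mul_prod_Ico _ hNs]
  refine Finset.prod_subset (Finset.range_mono h) fun j _ hj => ?_
  rw [expo_eq_zero_of_le (by simpa using hj), pow_zero]

/-- Cauchy estimate with radii adapted to `n`: they are `|ζ_j| + δ` in the first `N` variables, and
`(ε/2) e_j / m` in the others, where `e_j` are the exponents of `n` and `m` is their sum over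
`j ≥ N`. -/
theorem norm_taylorCoeff_mul_le {F : Ell1 → ℂ} (hF : IsAnalyticOnPolydisk F) {ζ : Ell1}
    {ε δ q₀ C : ℝ} (hε : 0 < ε) (hε1 : ε ≤ 1) (hδ : 0 < δ) (hq₀ : ∀ j, ‖ζ j‖ ≤ q₀)
    (hqδ : q₀ + δ < 1)
    (hC : ∀ κ : Ell1, (∀ j, ‖κ j‖ ≤ ‖ζ j‖) → ∀ ξ, dist ξ κ < ε → ‖F ξ‖ ≤ C)
    {N : ℕ} (hN : N * δ < ε / 2) {n : ℕ+} {s : ℕ} (hNs : N ≤ s) (hns : (n : ℕ) ≤ s) :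
    ‖taylorCoeff F n * monomial n ζ‖ ≤ C * ((∏ j ∈ Finset.range N, (q₀ / (q₀ + δ)) ^ expo n j) *
      (Nat.multinomial (Finset.Ico N s) (expo n) *
        ∏ j ∈ Finset.Ico N s, (2 * Real.exp 1 / ε * ‖ζ j‖) ^ expo n j)) := by
  have hq0 : 0 ≤ q₀ := (norm_nonneg _).trans (hq₀ 0)
  set S := Finset.Ico N s with hS
  set m : ℕ := ∑ j ∈ S, expo n j with hm
  have hem : ∀ j ∈ S, expo n j ≤ m := fun j hj =>
    Finset.single_le_sum (f := fun j => expo n j) (fun _ _ => Nat.zero_le _) hj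
  let R : ℕ → ℝ := fun j => if j < N then ‖ζ j‖ + δ else
    if j < s then ε / 2 * (expo n j / m) else 0
  have hR0 : ∀ j, 0 ≤ R j := fun j => by
    simp only [R]; split_ifs <;> positivity
  have hRlt : ∀ j, j < N → R j = ‖ζ j‖ + δ := fun j hj => if_pos hj
  have hRS : ∀ j ∈ S, R j = ε / 2 * (expo n j / m) := fun j hj => by
    have := Finset.mem_Ico.1 hj
    simp only [R]
    rw [if_neg (by omega), if_pos (by omega)]
  have hRs : ∀ j, s ≤ j → R j = 0 := fun j hj => by
    simp only [R]
    rw [if_neg (by omega), if_neg (by omega)]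
  have hfin : ∀ x : ℕ → ℂ, (∀ j, s ≤ j → x j = 0) → Summable fun j => ‖x j‖ := fun x hx =>
    summable_of_hasFiniteSupport ((Set.finite_Iio s).subset fun j hj => by
      by_contra h
      simp only [mem_Iio, not_lt] at h
      exact hj (by simp [hx j h]))
  let ρ : Ell1 := ell1Of (fun j => (R j : ℂ)) (hfin _ fun j hj => by simp [hRs j hj])
  have hρn : ∀ j, ‖ρ j‖ = R j := fun j => by
    simp only [ρ, ell1Of_apply, Complex.norm_real]
    exact Real.norm_of_nonneg (hR0 j)
  have hρ : ρ ∈ polydisk := by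
    intro j
    rw [hρn]
    rcases lt_or_ge j N with hj | hj
    · rw [hRlt j hj]; linarith [hq₀ j]
    · rcases lt_or_ge j s with hj' | hj'
      · have hjS : j ∈ S := Finset.mem_Ico.2 ⟨hj, hj'⟩
        rw [hRS j hjS]
        have : (expo n j : ℝ) / m ≤ 1 :=
          div_le_one_of_le₀ (by exact_mod_cast hem j hjS) (by positivity)
        nlinarith
      · rw [hRs j hj']; exact one_pos
  have hρ0 : ∀ j, expo n j ≠ 0 → 0 < R j := by
    intro j hj
    rcases lt_or_ge j N with hjN | hjN
    · rw [hRlt j hjN]; positivity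
    · have hjs : j < s := by
        by_contra h
        exact hj (expo_eq_zero_of_le (by omega))
      have hjS : j ∈ S := Finset.mem_Ico.2 ⟨hjN, hjs⟩
      rw [hRS j hjS]
      have h1 : 0 < expo n j := Nat.pos_of_ne_zero hj
      have h2 : 0 < m := h1.trans_le (hem j hjS)
      positivity
  have hbound : ∀ t, ‖F (torusPoint ρ t)‖ ≤ C := by
    intro t
    let κ : Ell1 := ell1Of (fun j => if j < N then ((‖ζ j‖ : ℝ) : ℂ) * circlePoint (t j) else 0)
      (hfin _ fun j hj => if_neg (by omega))
    refine hC κ (fun j => ?_) _ ?_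
    · simp only [κ, ell1Of_apply]
      split_ifs <;> simp [norm_circlePoint]
    · rw [dist_eq_norm]
      have hcoord : ∀ j, ‖(torusPoint ρ t - κ) j‖ =
          if j < N then δ else if j < s then ε / 2 * (expo n j / m) else 0 := by
        intro j
        have : (torusPoint ρ t - κ) j = (R j : ℂ) * circlePoint (t j) -
          if j < N then ((‖ζ j‖ : ℝ) : ℂ) * circlePoint (t j) else 0 := rfl
        rw [this]
        split_ifs with h1 h2
        · rw [hRlt j h1, ← sub_mul, norm_mul, norm_circlePoint]
          push_cast
          rw [add_sub_cancel_left, Complex.norm_real, Real.norm_of_nonneg hδ.le, mul_one]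
        · rw [sub_zero, norm_mul, norm_circlePoint, mul_one, Complex.norm_real,
            Real.norm_of_nonneg (hR0 j), hRS j (Finset.mem_Ico.2 ⟨by omega, h2⟩)]
        · rw [hRs j (by omega)]; simp
      have hsum : ‖torusPoint ρ t - κ‖ = ∑ j ∈ Finset.range s, ‖(torusPoint ρ t - κ) j‖ := by
        refine (ell1_hasSum_norm _).unique (hasSum_sum_of_ne_finset_zero fun j hj => ?_)
        simp only [Finset.mem_range, not_lt] at hj
        rw [hcoord, if_neg (by omega), if_neg (by omega)]
      rw [hsum, ← Finset.sum_range_add_sum_Ico _ hNs]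
      have e1 : ∑ j ∈ Finset.range N, ‖(torusPoint ρ t - κ) j‖ = N * δ := by
        rw [Finset.sum_congr rfl fun j hj => by
          rw [hcoord, if_pos (Finset.mem_range.1 hj)]]
        simp
      have e2 : ∑ j ∈ Finset.Ico N s, ‖(torusPoint ρ t - κ) j‖ ≤ ε / 2 := by
        rw [Finset.sum_congr rfl fun j hj => by
          rw [hcoord, if_neg (by have := Finset.mem_Ico.1 hj; omega),
            if_pos (Finset.mem_Ico.1 hj).2]]
        rw [← Finset.mul_sum, ← Finset.sum_div, ← Nat.cast_sum]
        exact mul_le_of_le_one_right (by positivity) (div_self_le_one _)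
      linarith
  have hC0 : 0 ≤ C := (norm_nonneg _).trans (hbound 0)
  have hcoeff := norm_cauchyCoeff_le (n := n) hbound
  rw [cauchyCoeff_eq_taylorCoeff hF hρ (s := s) (fun j hj => by simp [ρ, hRs j hj])
    (fun j hj => norm_pos_iff.1 (by rw [hρn]; exact hρ0 j hj)), norm_monomial] at hcoeff
  simp only [hρn] at hcoeff
  have hRpos : 0 < realMonomial n R := realMonomial_pos n hρ0
  rw [norm_mul, norm_monomial]
  have hmain : realMonomial n (fun j => ‖ζ j‖) ≤ realMonomial n R *
      ((∏ j ∈ Finset.range N, (q₀ / (q₀ + δ)) ^ expo n j) *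
      (Nat.multinomial S (expo n) * ∏ j ∈ S, (2 * Real.exp 1 / ε * ‖ζ j‖) ^ expo n j)) := by
    rw [realMonomial_eq_prod hNs hns, realMonomial_eq_prod hNs hns, mul_mul_mul_comm]
    refine mul_le_mul ?_ ?_ (Finset.prod_nonneg fun j _ => by positivity)
      (mul_nonneg (Finset.prod_nonneg fun j _ => pow_nonneg (hR0 j) _)
        (Finset.prod_nonneg fun j _ => by positivity))
    · rw [← Finset.prod_mul_distrib]
      refine Finset.prod_le_prod (fun j _ => by positivity) fun j hj => ?_
      rw [← mul_pow, hRlt j (Finset.mem_range.1 hj)]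
      refine pow_le_pow_left₀ (norm_nonneg _) ?_ _
      rw [← mul_div_assoc, le_div_iff₀ (by positivity)]
      nlinarith [hq₀ j]
    · have hmm := pow_sum_le_multinomial S (expo n)
      rw [← hm] at hmm
      have hexp : Real.exp m = ∏ j ∈ S, Real.exp 1 ^ expo n j := by
        rw [Finset.prod_pow_eq_pow_sum, ← hm, ← Real.exp_nat_mul, mul_one]
      have hmpow : (m : ℝ) ^ m = ∏ j ∈ S, (m : ℝ) ^ expo n j := by
        rw [Finset.prod_pow_eq_pow_sum]
      have hmul := mul_le_mul_of_nonneg_right hmm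
        (Finset.prod_nonneg fun j (_ : j ∈ S) => pow_nonneg (norm_nonneg (ζ j)) (expo n j))
      have hR' : ∏ j ∈ S, R j ^ expo n j =
          (∏ j ∈ S, (ε / 2) ^ expo n j) * (∏ j ∈ S, (expo n j : ℝ) ^ expo n j) / (m : ℝ) ^ m := by
        rw [hmpow, ← Finset.prod_mul_distrib, ← Finset.prod_div_distrib]
        refine Finset.prod_congr rfl fun j hj => ?_
        rw [hRS j hj, mul_pow, div_pow (expo n j : ℝ), mul_div_assoc]
      have hmpos : 0 < (m : ℝ) ^ m := by
        rcases Nat.eq_zero_or_pos m with h | h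
        · simp [h]
        · positivity
      have hy : ∏ j ∈ S, (2 * Real.exp 1 / ε * ‖ζ j‖) ^ expo n j =
          (∏ j ∈ S, (ε / 2) ^ expo n j)⁻¹ * Real.exp m * ∏ j ∈ S, ‖ζ j‖ ^ expo n j := by
        rw [hexp, ← Finset.prod_inv_distrib, ← Finset.prod_mul_distrib, ← Finset.prod_mul_distrib]
        refine Finset.prod_congr rfl fun j _ => ?_
        rw [← inv_pow, ← mul_pow, ← mul_pow]
        congr 2
        field_simp
      have hεpos : 0 < ∏ j ∈ S, (ε / 2) ^ expo n j := Finset.prod_pos fun j _ => by positivity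
      rw [hR', hy, div_mul_eq_mul_div, le_div_iff₀ hmpos]
      calc _ = (m : ℝ) ^ m * ∏ j ∈ S, ‖ζ j‖ ^ expo n j := mul_comm _ _
        _ ≤ _ := hmul
        _ = _ := by field_simp
  calc ‖taylorCoeff F n‖ * realMonomial n (fun j => ‖ζ j‖)
      ≤ ((realMonomial n R)⁻¹ * C) * (realMonomial n R * _) :=
        mul_le_mul hcoeff hmain (realMonomial_nonneg n fun j => norm_nonneg _)
          (mul_nonneg (inv_nonneg.2 hRpos.le) hC0)
    _ = _ := by field_simp

/-- The monomial expansion of an analytic function on `𝔻₁^∞` converges absolutely. -/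
theorem IsAnalyticOnPolydisk.summable_taylorCoeff {F : Ell1 → ℂ} (hF : IsAnalyticOnPolydisk F)
    {ζ : Ell1} (hζ : ζ ∈ polydisk) : Summable fun n => ‖taylorCoeff F n * monomial n ζ‖ := by
  obtain ⟨ε₀, hε₀, C, hC⟩ := hF.exists_uniform_bound hζ
  obtain ⟨q₀, hq0, hq1, hq⟩ := exists_lt_one_of_mem_polydisk hζ
  set ε := min ε₀ 1 with hε
  have hεpos : 0 < ε := lt_min hε₀ one_pos
  set y : ℕ → ℝ := fun j => 2 * Real.exp 1 / ε * ‖ζ j‖ with hy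
  have hy0 : ∀ j, 0 ≤ y j := fun j => by simp only [hy]; positivity
  have hys : Summable y := (ell1_hasSum_norm ζ).summable.mul_left _
  -- The first `N` variables get the fixed enlargement `δ` of their radii, which leads to geometric
  -- series; the radii of the other variables are proportional to their exponents, with sum `ε / 2`.
  obtain ⟨N, hN⟩ : ∃ N, ∑' j, y (j + N) < 1 / 2 :=
    ((tendsto_sum_nat_add y).eventually (gt_mem_nhds (by norm_num))).exists
  have htail : ∀ s, ∑ j ∈ Finset.Ico N s, y j ≤ 1 / 2 := by
    intro s
    rw [Finset.sum_Ico_eq_sum_range]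
    refine le_trans ?_ hN.le
    have hys' : Summable fun j => y (j + N) := (summable_nat_add_iff N).2 hys
    simp_rw [add_comm N]
    exact hys'.sum_le_tsum _ fun j _ => hy0 _
  set δ := min ((1 - q₀) / 2) (ε / (4 * (N + 1))) with hδ
  have hδpos : 0 < δ := lt_min (by linarith) (by positivity)
  have hqδ : q₀ + δ < 1 := by
    have : δ ≤ (1 - q₀) / 2 := min_le_left _ _
    linarith
  have hNδ : N * δ < ε / 2 := by
    have h1 : δ ≤ ε / (4 * (N + 1)) := min_le_right _ _
    have h2 : (N : ℝ) * δ ≤ N * (ε / (4 * (N + 1))) := by gcongr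
    have h3 : (N : ℝ) * (ε / (4 * (N + 1))) ≤ ε / 4 := by
      rw [← mul_div_assoc, div_le_div_iff₀ (by positivity) (by positivity)]
      nlinarith
    linarith
  have hC' : ∀ κ : Ell1, (∀ j, ‖κ j‖ ≤ ‖ζ j‖) → ∀ ξ, dist ξ κ < ε → ‖F ξ‖ ≤ C :=
    fun κ hκ ξ hξ => hC κ hκ ξ (hξ.trans_le (min_le_left _ _))
  have hC0 : 0 ≤ C := (norm_nonneg _).trans (hC ζ (fun j => le_rfl) ζ (by simpa using hε₀))
  have hqq : q₀ / (q₀ + δ) < 1 := (div_lt_one (by positivity)).2 (by linarith)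
  refine summable_of_sum_le (c := C * (((1 - q₀ / (q₀ + δ))⁻¹) ^ N * (1 - 1 / 2)⁻¹))
    (fun n => norm_nonneg _) fun T => ?_
  set s := N + T.sup (fun n => (n : ℕ)) with hs
  have hT : ∀ n ∈ T, (n : ℕ) ≤ s := fun n hn =>
    (Finset.le_sup (f := fun n : ℕ+ => (n : ℕ)) hn).trans (by omega)
  refine (Finset.sum_le_sum fun n hn => norm_taylorCoeff_mul_le hF hεpos (min_le_right _ _) hδpos hq
    hqδ hC' hNδ (s := s) (by omega) (hT n hn)).trans ?_
  rw [← Finset.mul_sum]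
  exact mul_le_mul_of_nonneg_left (sum_geometric_multinomial_le (by positivity) hqq
    (by norm_num) hy0 (by omega) (htail s) T hT) hC0

/-- Every analytic function on `𝔻₁^∞` has a monomial expansion. -/
theorem IsAnalyticOnPolydisk.hasMonomialExpansion {F : Ell1 → ℂ} (hF : IsAnalyticOnPolydisk F) :
    HasMonomialExpansion F (taylorCoeff F) := by
  intro ζ hζ
  have hsum := hF.summable_taylorCoeff hζ
  have htsum : Summable fun n => taylorCoeff F n * monomial n ζ := hsum.of_norm
  let Z : ℕ → Ell1 := fun s => ∑ j ∈ Finset.range s, lp.single 1 j (ζ j)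
  have hZlim : Filter.Tendsto Z Filter.atTop (𝓝 ζ) :=
    (lp.hasSum_single (p := 1) (by simp) ζ).tendsto_sum_nat
  have hZ : ∀ s j, Z s j = if j < s then ζ j else 0 := by
    intro s j
    simp only [Z]
    rw [lp.coeFn_sum, Finset.sum_apply]
    simp only [lp.single_apply, Pi.single_apply]
    simp
  have hZle : ∀ s j, ‖Z s j‖ ≤ ‖ζ j‖ := fun s j => by rw [hZ]; split_ifs <;> simp
  have hZmem : ∀ s, Z s ∈ polydisk := fun s j => (hZle s j).trans_lt (hζ j)
  have hFlim : Filter.Tendsto (fun s => F (Z s)) Filter.atTop (𝓝 (F ζ)) :=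
    ((hF.continuousOn.continuousAt (isOpen_polydisk.mem_nhds hζ)).tendsto).comp hZlim
  have hlim : Filter.Tendsto (fun s => ∑' n, taylorCoeff F n * monomial n (Z s)) Filter.atTop
      (𝓝 (∑' n, taylorCoeff F n * monomial n ζ)) := by
    refine tendsto_tsum_of_dominated_convergence hsum (fun n => ?_)
      (Filter.Eventually.of_forall fun s n => ?_)
    · refine tendsto_const_nhds.congr' ?_
      filter_upwards [Filter.eventually_ge_atTop (n : ℕ)] with s hs
      congr 1
      refine Finset.prod_congr rfl fun j hj => ?_
      rw [hZ, if_pos ((Finset.mem_range.1 hj).trans_le hs)]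
    · rw [norm_mul, norm_mul, norm_monomial, norm_monomial]
      exact mul_le_mul_of_nonneg_left
        (realMonomial_mono n (fun j => norm_nonneg _) (hZle s)) (norm_nonneg _)
  have heq : (fun s => F (Z s)) = fun s => ∑' n, taylorCoeff F n * monomial n (Z s) :=
    funext fun s => (hasSum_taylorCoeff_of_finite hF (hZmem s) (s := s)
      fun j hj => by rw [hZ, if_neg (by omega)]).tsum_eq.symm
  rw [← heq] at hlim
  rw [tendsto_nhds_unique hFlim hlim]
  exact htsum.hasSum

/-! ### Dilations, Hardy norms and square summable coefficients -/

/-- The factor `∏_j r^{(j+1) e_j}` by which the dilation `F ↦ F_[r]` multiplies the `n`-th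
coefficient; `e_j` are the exponents of `n`. -/
def dilationWeight (r : ℝ) (n : ℕ+) : ℝ := realMonomial n fun j => r ^ (j + 1)

theorem dilationWeight_nonneg {r : ℝ} (hr : 0 ≤ r) (n : ℕ+) : 0 ≤ dilationWeight r n :=
  realMonomial_nonneg n fun _ => pow_nonneg hr _

theorem dilationWeight_mono {r s : ℝ} (hr : 0 ≤ r) (h : r ≤ s) (n : ℕ+) :
    dilationWeight r n ≤ dilationWeight s n :=
  realMonomial_mono n (fun _ => pow_nonneg hr _) fun _ => pow_le_pow_left₀ hr h _

theorem dilationWeight_le_one {r : ℝ} (hr : 0 ≤ r) (h : r ≤ 1) (n : ℕ+) :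
    dilationWeight r n ≤ 1 :=
  realMonomial_le_one n (fun _ => pow_nonneg hr _) fun _ => pow_le_one₀ hr h

theorem dilationWeight_one (n : ℕ+) : dilationWeight 1 n = 1 := by
  simp [dilationWeight, realMonomial]

theorem continuous_dilationWeight (n : ℕ+) : Continuous fun r : ℝ => dilationWeight r n := by
  unfold dilationWeight realMonomial
  fun_prop

theorem monomial_dilatedPoint (n : ℕ+) (r : Ioo (0 : ℝ) 1) (t : Torus) :
    monomial n (dilatedPoint r t)
      = (dilationWeight r n : ℂ) * monomial n fun j => circlePoint (t j) := by
  have h : (dilatedPoint r t : ℕ → ℂ)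
      = fun j => (((r : ℝ) ^ (j + 1) : ℝ) : ℂ) * circlePoint (t j) := by
    funext j
    rw [dilatedPoint_apply]
    push_cast
    rfl
  rw [h, monomial_mul, monomial_ofReal, dilationWeight]

/-- A sequence of radii increasing to `1`. -/
def radius (k : ℕ) : Ioo (0 : ℝ) 1 :=
  ⟨1 - 1 / ((k : ℝ) + 2), by
    have : (1 : ℝ) / ((k : ℝ) + 2) < 1 := by
      rw [div_lt_one (by positivity)]; linarith [Nat.cast_nonneg (α := ℝ) k]
    constructor
    · linarith
    · have : (0 : ℝ) < 1 / ((k : ℝ) + 2) := by positivity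
      linarith⟩

theorem tendsto_radius : Filter.Tendsto (fun k => (radius k : ℝ)) Filter.atTop (𝓝 1) := by
  have h : Filter.Tendsto (fun k : ℕ => 1 / ((k : ℝ) + 2)) Filter.atTop (𝓝 0) := by
    have := (tendsto_one_div_add_atTop_nhds_zero_nat (𝕜 := ℝ)).comp (Filter.tendsto_add_atTop_nat 1)
    refine this.congr fun k => ?_
    simp only [Function.comp_apply]
    push_cast
    ring
  simpa [radius] using h.const_sub 1

theorem monotone_radius : Monotone radius := by
  intro a b h
  have h' : (a : ℝ) ≤ b := by exact_mod_cast h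
  change 1 - 1 / ((a : ℝ) + 2) ≤ 1 - 1 / ((b : ℝ) + 2)
  gcongr

theorem exists_le_radius (r : Ioo (0 : ℝ) 1) : ∃ k, r ≤ radius k := by
  obtain ⟨k, hk⟩ := (tendsto_radius.eventually (lt_mem_nhds r.2.2)).exists
  exact ⟨k, Subtype.coe_le_coe.1 (le_of_lt hk)⟩

theorem tendsto_dilationWeight_radius (n : ℕ+) :
    Filter.Tendsto (fun k => dilationWeight (radius k) n) Filter.atTop (𝓝 1) := by
  have := ((continuous_dilationWeight n).tendsto 1).comp tendsto_radius
  rwa [dilationWeight_one] at this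

theorem HasMonomialExpansion.summable_dilationWeight {F : Ell1 → ℂ} {a : ℕ+ → ℂ}
    (h : HasMonomialExpansion F a) (r : Ioo (0 : ℝ) 1) :
    Summable fun n => ‖a n * (dilationWeight r n : ℂ)‖ := by
  refine ((h _ (dilatedPoint_mem r 0)).summable.norm).congr fun n => ?_
  rw [monomial_dilatedPoint, norm_mul, norm_mul, norm_mul, norm_monomial_circlePoint, mul_one]

theorem HasMonomialExpansion.hasSum_dilate {F : Ell1 → ℂ} {a : ℕ+ → ℂ}
    (h : HasMonomialExpansion F a) (r : Ioo (0 : ℝ) 1) (t : Torus) :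
    HasSum (fun n => a n * (dilationWeight r n : ℂ) * monomial n fun j => circlePoint (t j))
      (dilate F r t) := by
  have := h _ (dilatedPoint_mem r t)
  simp_rw [monomial_dilatedPoint, ← mul_assoc] at this
  exact this

theorem HasMonomialExpansion.lintegral_dilate_sq {F : Ell1 → ℂ} {a : ℕ+ → ℂ}
    (h : HasMonomialExpansion F a) (r : Ioo (0 : ℝ) 1) :
    ∫⁻ t, ‖dilate F r t‖ₑ ^ (2 : ℝ) ∂torusMeasure
      = ∑' n, ‖a n * (dilationWeight r n : ℂ)‖ₑ ^ 2 := by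
  rw [← lintegral_sq_tsum_monomial (h.summable_dilationWeight r)]
  exact lintegral_congr fun t => by rw [(h.hasSum_dilate r t).tsum_eq]

theorem HasMonomialExpansion.lintegral_dilate_sq_mono {F : Ell1 → ℂ} {a : ℕ+ → ℂ}
    (h : HasMonomialExpansion F a) {r s : Ioo (0 : ℝ) 1} (hrs : r ≤ s) :
    ∫⁻ t, ‖dilate F r t‖ₑ ^ (2 : ℝ) ∂torusMeasure
      ≤ ∫⁻ t, ‖dilate F s t‖ₑ ^ (2 : ℝ) ∂torusMeasure := by
  rw [h.lintegral_dilate_sq, h.lintegral_dilate_sq]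
  refine ENNReal.tsum_le_tsum fun n => ?_
  gcongr
  rw [enorm_le_iff_norm_le, norm_mul, norm_mul, Complex.norm_real, Complex.norm_real,
    Real.norm_of_nonneg (dilationWeight_nonneg r.2.1.le n),
    Real.norm_of_nonneg (dilationWeight_nonneg s.2.1.le n)]
  exact mul_le_mul_of_nonneg_left (dilationWeight_mono r.2.1.le hrs n) (norm_nonneg _)

theorem HasMonomialExpansion.hardyNormPow_two {F : Ell1 → ℂ} {a : ℕ+ → ℂ}
    (h : HasMonomialExpansion F a) : hardyNormPow 2 F = ∑' n, ‖a n‖ₑ ^ 2 := by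
  refine le_antisymm (iSup_le fun r => ?_) ?_
  · rw [h.lintegral_dilate_sq]
    refine ENNReal.tsum_le_tsum fun n => ?_
    gcongr
    rw [enorm_le_iff_norm_le, norm_mul, Complex.norm_real,
      Real.norm_of_nonneg (dilationWeight_nonneg r.2.1.le n)]
    exact mul_le_of_le_one_right (norm_nonneg _) (dilationWeight_le_one r.2.1.le r.2.2.le n)
  · rw [ENNReal.tsum_eq_iSup_sum]
    refine iSup_le fun T => ?_
    have hlim : Filter.Tendsto
        (fun k => ∑ n ∈ T, ‖a n * (dilationWeight (radius k) n : ℂ)‖ₑ ^ 2) Filter.atTop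
        (𝓝 (∑ n ∈ T, ‖a n‖ₑ ^ 2)) := by
      refine tendsto_finsetSum _ fun n _ => ?_
      have h1 : Filter.Tendsto (fun k => a n * (dilationWeight (radius k) n : ℂ)) Filter.atTop
          (𝓝 (a n)) := by
        simpa using ((Complex.continuous_ofReal.tendsto 1).comp
          (tendsto_dilationWeight_radius n)).const_mul (a n)
      exact ((ENNReal.continuous_pow 2).tendsto _).comp ((continuous_enorm.tendsto _).comp h1)
    refine le_of_tendsto' hlim fun k => ?_
    refine (ENNReal.sum_le_tsum T).trans ?_
    rw [← h.lintegral_dilate_sq]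
    exact le_iSup
      (fun r : Ioo (0 : ℝ) 1 => ∫⁻ t, ‖dilate F r t‖ₑ ^ (2 : ℝ) ∂torusMeasure) (radius k)

/-- The integral means of even order are monotone in the radius, by Parseval's identity for the
power `F ^ k`. -/
theorem IsAnalyticOnPolydisk.lintegral_dilate_even_mono {F : Ell1 → ℂ}
    (hF : IsAnalyticOnPolydisk F) (k : ℕ) {r s : Ioo (0 : ℝ) 1} (hrs : r ≤ s) :
    ∫⁻ t, ‖dilate F r t‖ₑ ^ (2 * k) ∂torusMeasure
      ≤ ∫⁻ t, ‖dilate F s t‖ₑ ^ (2 * k) ∂torusMeasure := by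
  have h := (hF.pow k).hasMonomialExpansion.lintegral_dilate_sq_mono hrs
  have e : ∀ (r : Ioo (0 : ℝ) 1) (t : Torus),
      ‖dilate (fun ζ => F ζ ^ k) r t‖ₑ ^ (2 : ℝ) = ‖dilate F r t‖ₑ ^ (2 * k) := by
    intro r t
    simp only [dilate]
    rw [enorm_pow, mul_comm, pow_mul]
    norm_cast
  simpa only [e] using h

theorem rpow_le_one_add_rpow (x : ℝ≥0∞) {p q : ℝ} (hp : 0 ≤ p) (hpq : p ≤ q) :
    x ^ p ≤ 1 + x ^ q := by
  rcases le_total x 1 with h | h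
  · exact (ENNReal.rpow_le_one h hp).trans le_self_add
  · exact (ENNReal.rpow_le_rpow_of_exponent_le h hpq).trans le_add_self

theorem hardyNormPow_le_one_add (F : Ell1 → ℂ) {p q : ℝ} (hp : 0 ≤ p) (hpq : p ≤ q) :
    hardyNormPow p F ≤ 1 + hardyNormPow q F := by
  refine iSup_le fun r => ?_
  calc ∫⁻ t, ‖dilate F r t‖ₑ ^ p ∂torusMeasure
      ≤ ∫⁻ t, 1 + ‖dilate F r t‖ₑ ^ q ∂torusMeasure :=
        lintegral_mono fun t => rpow_le_one_add_rpow _ hp hpq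
    _ = 1 + ∫⁻ t, ‖dilate F r t‖ₑ ^ q ∂torusMeasure := by
        rw [lintegral_add_left measurable_const]; simp
    _ ≤ _ := by
        gcongr
        exact le_iSup (fun r : Ioo (0 : ℝ) 1 => ∫⁻ t, ‖dilate F r t‖ₑ ^ q ∂torusMeasure) r

theorem hasMonomialExpansion_monomialCoeff {F : Ell1 → ℂ} (hF : IsAnalyticOnPolydisk F) :
    HasMonomialExpansion F (monomialCoeff F) := by
  have h : ∃ a, HasMonomialExpansion F a := ⟨_, hF.hasMonomialExpansion⟩
  rw [monomialCoeff, dif_pos h]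
  exact h.choose_spec

theorem mem_hardySpace_two_iff {F : Ell1 → ℂ} (hF : IsAnalyticOnPolydisk F) :
    F ∈ HardySpace 2 ↔ ∑' n, ‖monomialCoeff F n‖ₑ ^ 2 < ∞ := by
  rw [← (hasMonomialExpansion_monomialCoeff hF).hardyNormPow_two]
  exact and_iff_right hF

theorem norm_mul_monomial_le (b : ℕ+ → ℂ) (n : ℕ+) {ξ : ℕ → ℂ} (h : ∀ j, ‖ξ j‖ ≤ 1) :
    ‖b n * monomial n ξ‖ ≤ ‖b n‖ ^ 2 + realMonomial n (fun j => ‖ξ j‖) := by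
  rw [norm_mul, norm_monomial]
  have h0 := realMonomial_nonneg n (x := fun j => ‖ξ j‖) fun j => norm_nonneg _
  have h1 := realMonomial_le_one n (x := fun j => ‖ξ j‖) (fun j => norm_nonneg _) h
  nlinarith [sq_nonneg (‖b n‖ - realMonomial n (fun j => ‖ξ j‖)), norm_nonneg (b n)]

/-- A square summable coefficient sequence defines an analytic function on `𝔻₁^∞`. -/
theorem exists_analytic_of_summable_sq {b : ℕ+ → ℂ} (hb : Summable fun n => ‖b n‖ ^ 2) :
    ∃ G, IsAnalyticOnPolydisk G ∧ HasMonomialExpansion G b := by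
  have hsum : ∀ ζ ∈ polydisk, Summable fun n => ‖b n * monomial n ζ‖ := by
    intro ζ hζ
    obtain ⟨q, -, hq1, hq⟩ := exists_lt_one_of_mem_polydisk hζ
    exact Summable.of_nonneg_of_le (fun n => norm_nonneg _)
      (fun n => norm_mul_monomial_le b n fun j => (hζ j).le)
      (hb.add (summable_realMonomial hq1 (fun j => norm_nonneg _) hq (ell1_hasSum_norm ζ).summable))
  refine ⟨fun ζ => ∑' n, b n * monomial n ζ, ⟨fun ζ hζ => ?_, fun ζ hζ η => ?_⟩,
    fun ζ hζ => (hsum ζ hζ).of_norm.hasSum⟩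
  · obtain ⟨q, hq0, hq1, hq⟩ := exists_lt_one_of_mem_polydisk hζ
    refine ⟨Metric.ball ζ ((1 - q) / 2), Metric.ball_mem_nhds _ (by linarith),
      ∑' n, ‖b n‖ ^ 2 + Real.exp ((‖ζ‖ + 1) / (1 - (1 + q) / 2)), fun ξ hξ => ?_⟩
    have hξd : ‖ξ - ζ‖ < (1 - q) / 2 := mem_ball_iff_norm.1 hξ.1
    have hξq : ∀ j, ‖ξ j‖ ≤ (1 + q) / 2 := by
      intro j
      have h1 : ‖(ξ - ζ) j‖ ≤ ‖ξ - ζ‖ := lp.norm_apply_le_norm (by simp) _ j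
      calc ‖ξ j‖ = ‖ζ j + (ξ - ζ) j‖ := by simp
        _ ≤ ‖ζ j‖ + ‖(ξ - ζ) j‖ := norm_add_le _ _
        _ ≤ _ := by linarith [hq j]
    have hq' : (1 + q) / 2 < 1 := by linarith
    have hs := summable_realMonomial hq' (fun j => norm_nonneg (ξ j)) hξq
      (ell1_hasSum_norm ξ).summable
    calc ‖∑' n, b n * monomial n ξ‖ ≤ ∑' n, ‖b n * monomial n ξ‖ :=
          norm_tsum_le_tsum_norm (hsum ξ hξ.2)
      _ ≤ ∑' n, (‖b n‖ ^ 2 + realMonomial n (fun j => ‖ξ j‖)) :=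
          (hsum ξ hξ.2).tsum_le_tsum (fun n => norm_mul_monomial_le b n fun j => (hξ.2 j).le)
            (hb.add hs)
      _ = ∑' n, ‖b n‖ ^ 2 + ∑' n : ℕ+, realMonomial n (fun j => ‖ξ j‖) := hb.tsum_add hs
      _ ≤ _ := by
          gcongr
          refine (hs.tsum_le_of_sum_le fun T => sum_realMonomial_le hq' (fun j => norm_nonneg (ξ j))
            hξq (ell1_hasSum_norm ξ).summable T).trans ?_
          rw [(ell1_hasSum_norm ξ).tsum_eq]
          have : ‖ξ‖ ≤ ‖ζ‖ + 1 := by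
            have := norm_le_norm_add_norm_sub' ξ ζ
            linarith
          have h2 : 0 < 1 - (1 + q) / 2 := by linarith
          gcongr
  · intro z₀ hz₀
    obtain ⟨q, hq0, hq1, hq⟩ := exists_lt_one_of_mem_polydisk hz₀
    set δ : ℝ := (1 - q) / (2 * (‖η‖ + 1)) with hδ
    have hη := norm_nonneg η
    have hδ0 : 0 < δ := div_pos (by linarith) (by positivity)
    have hδη : δ * ‖η‖ ≤ (1 - q) / 2 := by
      rw [hδ, div_mul_eq_mul_div, div_le_div_iff₀ (by positivity) two_pos]
      nlinarith
    set x : ℕ → ℝ := fun j => ‖(ζ + z₀ • η) j‖ + δ * ‖η j‖ with hx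
    have hxs : Summable x :=
      (ell1_hasSum_norm _).summable.add ((ell1_hasSum_norm η).summable.mul_left δ)
    have hx0 : ∀ j, 0 ≤ x j := fun j => by simp only [hx]; positivity
    have hxq : ∀ j, x j ≤ (1 + q) / 2 := by
      intro j
      have h1 : ‖η j‖ ≤ ‖η‖ := lp.norm_apply_le_norm (by simp) _ j
      have h2 : δ * ‖η j‖ ≤ δ * ‖η‖ := by gcongr
      simp only [hx]
      linarith [hq j]
    have hdom : Summable fun n : ℕ+ => ‖b n‖ ^ 2 + realMonomial n x :=
      hb.add (summable_realMonomial (by linarith) hx0 hxq hxs)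
    have hle : ∀ z ∈ Metric.ball z₀ δ, ∀ j, ‖(ζ + z • η) j‖ ≤ x j := by
      intro z hz j
      have e : (ζ + z • η) j = (ζ + z₀ • η) j + (z - z₀) * η j := by
        change ζ j + z * η j = ζ j + z₀ * η j + (z - z₀) * η j
        ring
      rw [e]
      refine (norm_add_le _ _).trans ?_
      simp only [hx]
      gcongr
      rw [norm_mul]
      have : ‖z - z₀‖ ≤ δ := (mem_ball_iff_norm.1 hz).le
      gcongr
    refine DifferentiableOn.analyticAt (s := Metric.ball z₀ δ) ?_ (Metric.ball_mem_nhds _ hδ0)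
    refine Complex.differentiableOn_tsum_of_summable_norm hdom (fun n => ?_) Metric.isOpen_ball
      fun n z hz => ?_
    · refine DifferentiableOn.const_mul (DifferentiableOn.fun_finsetProd fun j _ => ?_) _
      have : (fun z : ℂ => (ζ + z • η) j ^ expo n j) = fun z => (ζ j + z * η j) ^ expo n j := rfl
      rw [this]
      fun_prop
    · refine (norm_mul_monomial_le b n fun j => ?_).trans ?_
      · linarith [hle z hz j, hxq j]
      · gcongr
        exact realMonomial_mono n (fun j => norm_nonneg _) (hle z hz)

/-! ### Standard random sequences and Khintchine inequalities -/

/-- The properties of standard random sequences on which the theorem depends: independence, mean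
zero, unit second moments, and a subgaussian bound for the real part of every multiple. -/
structure IsSubgaussianSeq {Ω : Type*} [MeasurableSpace Ω] (X : ℕ+ → Ω → ℂ) (P : Measure Ω) :
    Prop where
  measurable : ∀ n, Measurable (X n)
  indep : iIndepFun X P
  subgaussian : ∀ n (c : ℂ), HasSubgaussianMGF (fun ω => (c * X n ω).re) (‖c‖₊ ^ 2) P
  integral_eq_zero : ∀ n, ∫ ω, X n ω ∂P = 0
  integrable_norm_sq : ∀ n, Integrable (fun ω => ‖X n ω‖ ^ 2) P
  integral_norm_sq : ∀ n, ∫ ω, ‖X n ω‖ ^ 2 ∂P = 1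

theorem IsSubgaussianSeq.memLp_two {Ω : Type*} [MeasurableSpace Ω] {X : ℕ+ → Ω → ℂ}
    {P : Measure Ω} (hX : IsSubgaussianSeq X P) (n : ℕ+) : MemLp (X n) 2 P :=
  (memLp_two_iff_integrable_sq_norm (hX.measurable n).aestronglyMeasurable).2
    (hX.integrable_norm_sq n)

section StandardSequences

variable {Ω : Type*} [MeasurableSpace Ω] {P : Measure Ω}

/-- Hoeffding's lemma for a centred random variable on the unit circle. -/
theorem hasSubgaussianMGF_re_of_norm_eq_one [IsProbabilityMeasure P] {Y : Ω → ℂ}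
    (hY : Measurable Y)
    (h1 : ∀ᵐ ω ∂P, ‖Y ω‖ = 1) (h0 : ∫ ω, Y ω ∂P = 0) (c : ℂ) :
    HasSubgaussianMGF (fun ω => (c * Y ω).re) (‖c‖₊ ^ 2) P := by
  have hint : Integrable Y P := Integrable.of_bound hY.aestronglyMeasurable 1
    (h1.mono fun ω h => h.le)
  have h := hasSubgaussianMGF_of_mem_Icc_of_integral_eq_zero (μ := P)
    (X := fun ω => (c * Y ω).re) (a := -‖c‖) (b := ‖c‖)
    (Complex.measurable_re.comp (hY.const_mul c)).aemeasurable
    (h1.mono fun ω hω => by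
      have := Complex.abs_re_le_norm (c * Y ω)
      rw [norm_mul, hω, mul_one] at this
      exact abs_le.1 this)
    (by
      have : ∫ ω, (c * Y ω).re ∂P = (∫ ω, c * Y ω ∂P).re :=
        integral_re (𝕜 := ℂ) (hint.const_mul c)
      rw [this, integral_const_mul, h0, mul_zero, Complex.zero_re])
  convert h using 1
  have e : ‖c‖ - -‖c‖ = 2 * ‖c‖ := by ring
  rw [e, nnnorm_mul, nnnorm_norm]
  congr 1
  apply NNReal.eq
  simp

theorem integral_norm_sq_of_norm_eq_one [IsProbabilityMeasure P] {Y : Ω → ℂ}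
    (h1 : ∀ᵐ ω ∂P, ‖Y ω‖ = 1) :
    Integrable (fun ω => ‖Y ω‖ ^ 2) P ∧ ∫ ω, ‖Y ω‖ ^ 2 ∂P = 1 := by
  have h : (fun ω => ‖Y ω‖ ^ 2) =ᵐ[P] fun _ => 1 := h1.mono fun ω hω => by simp [hω]
  exact ⟨(integrable_const 1).congr h.symm, by rw [integral_congr_ae h]; simp⟩

theorem bernoulli_norm_and_integral [IsProbabilityMeasure P] {Y : Ω → ℂ} (hY : Measurable Y)
    (h1 : P {ω | Y ω = 1} = 1 / 2) (h2 : P {ω | Y ω = -1} = 1 / 2) :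
    (∀ᵐ ω ∂P, ‖Y ω‖ = 1) ∧ ∫ ω, Y ω ∂P = 0 := by
  have hm1 : MeasurableSet {ω | Y ω = 1} := hY (measurableSet_singleton 1)
  have hm2 : MeasurableSet {ω | Y ω = -1} := hY (measurableSet_singleton (-1))
  have hdisj : Disjoint {ω | Y ω = 1} {ω | Y ω = -1} := by
    refine Set.disjoint_left.2 fun ω (h : Y ω = 1) (h' : Y ω = -1) => ?_
    rw [h] at h'
    norm_num at h'
  have hall : ∀ᵐ ω ∂P, Y ω = 1 ∨ Y ω = -1 := by
    have : P ({ω | Y ω = 1} ∪ {ω | Y ω = -1}) = 1 := by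
      rw [measure_union hdisj hm2, h1, h2, ENNReal.add_halves]
    exact (mem_ae_iff_prob_eq_one (hm1.union hm2)).2 this
  refine ⟨hall.mono fun ω h => by rcases h with h | h <;> simp [h], ?_⟩
  have hae : Y =ᵐ[P] fun ω => {ω | Y ω = 1}.indicator (fun _ => (1 : ℂ)) ω +
      {ω | Y ω = -1}.indicator (fun _ => (-1 : ℂ)) ω := by
    filter_upwards [hall] with ω h
    rcases h with h | h
    · have h' : ¬ Y ω = -1 := by rw [h]; norm_num
      rw [indicator_of_mem (show ω ∈ {ω | Y ω = 1} from h),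
        indicator_of_notMem (show ω ∉ {ω | Y ω = -1} from h'), h, add_zero]
    · have h' : ¬ Y ω = 1 := by rw [h]; norm_num
      rw [indicator_of_notMem (show ω ∉ {ω | Y ω = 1} from h'),
        indicator_of_mem (show ω ∈ {ω | Y ω = -1} from h), h, zero_add]
  rw [integral_congr_ae hae, integral_add ((integrable_const _).indicator hm1)
    ((integrable_const _).indicator hm2), integral_indicator_const _ hm1,
    integral_indicator_const _ hm2, measureReal_def, measureReal_def, h1, h2]
  simp

theorem steinhaus_norm_and_integral {Y : Ω → ℂ} (hY : Measurable Y)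
    (h : P.map Y = (AddCircle.haarAddCircle : Measure UnitAddCircle).map circlePoint) :
    (∀ᵐ ω ∂P, ‖Y ω‖ = 1) ∧ ∫ ω, Y ω ∂P = 0 := by
  have hc : Measurable circlePoint := continuous_circlePoint.measurable
  constructor
  · have hs : MeasurableSet {z : ℂ | ‖z‖ = 1} :=
      measurableSet_eq_fun measurable_norm measurable_const
    have : ∀ᵐ z ∂(P.map Y), ‖z‖ = 1 := by
      rw [h, ae_map_iff hc.aemeasurable hs]
      exact Filter.Eventually.of_forall norm_circlePoint
    rwa [ae_map_iff hY.aemeasurable hs] at this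
  · have e : ∫ ω, Y ω ∂P = ∫ z, z ∂(P.map Y) :=
      (integral_map hY.aemeasurable measurable_id'.aestronglyMeasurable).symm
    rw [e, h, integral_map hc.aemeasurable measurable_id'.aestronglyMeasurable]
    simpa using integral_circlePoint_pow_conj (a := 1) (b := 0) one_ne_zero

theorem gaussian_moments {Y : Ω → ℂ} (hY : Measurable Y)
    (h : P.map Y = (gaussianReal 0 1).map (fun x : ℝ => (x : ℂ))) :
    (∀ c : ℂ, HasSubgaussianMGF (fun ω => (c * Y ω).re) (‖c‖₊ ^ 2) P) ∧ ∫ ω, Y ω ∂P = 0 ∧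
      Integrable (fun ω => ‖Y ω‖ ^ 2) P ∧ ∫ ω, ‖Y ω‖ ^ 2 ∂P = 1 := by
  have ho : Measurable (fun x : ℝ => (x : ℂ)) := Complex.measurable_ofReal
  have hI : ∀ f : ℂ → ℝ, Measurable f →
      ∫ ω, f (Y ω) ∂P = ∫ x, f (x : ℂ) ∂(gaussianReal 0 1) := by
    intro f hf
    rw [← integral_map hY.aemeasurable hf.aestronglyMeasurable, h,
      integral_map ho.aemeasurable hf.aestronglyMeasurable]
  have hint : ∀ f : ℂ → ℝ, Measurable f → Integrable (fun x : ℝ => f (x : ℂ)) (gaussianReal 0 1) →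
      Integrable (fun ω => f (Y ω)) P := by
    intro f hf hi
    refine (integrable_map_measure hf.aestronglyMeasurable hY.aemeasurable).1 ?_
    rw [h]
    exact (integrable_map_measure hf.aestronglyMeasurable ho.aemeasurable).2 hi
  have hsq : ∫ x, x ^ 2 ∂(gaussianReal 0 1) = 1 := by
    have hv := variance_fun_id_gaussianReal (μ := 0) (v := 1)
    rw [variance_of_integral_eq_zero (by fun_prop) (by simp)] at hv
    simpa using hv
  have hsqi : Integrable (fun x : ℝ => x ^ 2) (gaussianReal 0 1) :=
    (memLp_id_gaussianReal (μ := 0) (v := 1) 2).integrable_sq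
  refine ⟨fun c => ⟨fun t => ?_, fun t => ?_⟩, ?_, ?_, ?_⟩
  · refine hint (fun z => Real.exp (t * (c * z).re)) (by fun_prop) ?_
    have := integrable_exp_mul_gaussianReal (μ := 0) (v := 1) (t * c.re)
    simpa [mul_assoc] using this
  · have e : mgf (fun ω => (c * Y ω).re) P t = mgf id (gaussianReal 0 1) (t * c.re) := by
      rw [mgf, hI (fun z => Real.exp (t * (c * z).re)) (by fun_prop), mgf]
      simp [mul_assoc]
    rw [e, mgf_id_gaussianReal]
    simp only [zero_mul, zero_add, NNReal.coe_one, one_mul, NNReal.coe_pow, coe_nnnorm]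
    refine Real.exp_le_exp.2 ?_
    have h1 : c.re ^ 2 ≤ ‖c‖ ^ 2 := sq_le_sq'
      (by linarith [(abs_le.1 (Complex.abs_re_le_norm c)).1])
      (Complex.re_le_norm c)
    have h2 : (t * c.re) ^ 2 ≤ ‖c‖ ^ 2 * t ^ 2 := by
      rw [mul_pow, mul_comm]
      gcongr
    linarith
  · have e : ∫ ω, Y ω ∂P = ∫ z, z ∂(P.map Y) :=
      (integral_map hY.aemeasurable measurable_id'.aestronglyMeasurable).symm
    rw [e, h, integral_map ho.aemeasurable measurable_id'.aestronglyMeasurable,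
      integral_complex_ofReal]
    simp
  · refine hint (fun z => ‖z‖ ^ 2) (by fun_prop) ?_
    simpa using hsqi
  · rw [hI (fun z => ‖z‖ ^ 2) (by fun_prop)]
    simpa using hsq

theorem IsStandardRandomSeq.isSubgaussianSeq [IsProbabilityMeasure P] {X : ℕ+ → Ω → ℂ}
    (hX : IsStandardRandomSeq X P) :
    IsSubgaussianSeq X P := by
  obtain ⟨hm, hi, hX⟩ := hX
  have hcircle : (∀ n, (∀ᵐ ω ∂P, ‖X n ω‖ = 1) ∧ ∫ ω, X n ω ∂P = 0) → IsSubgaussianSeq X P :=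
    fun h => ⟨hm, hi, fun n c => hasSubgaussianMGF_re_of_norm_eq_one (hm n) (h n).1 (h n).2 c,
      fun n => (h n).2, fun n => (integral_norm_sq_of_norm_eq_one (h n).1).1,
      fun n => (integral_norm_sq_of_norm_eq_one (h n).1).2⟩
  rcases hX with h | h | h
  · exact hcircle fun n => bernoulli_norm_and_integral (hm n) (h n).1 (h n).2
  · exact hcircle fun n => steinhaus_norm_and_integral (hm n) (h n)
  · exact ⟨hm, hi, fun n => (gaussian_moments (hm n) (h n)).1,
      fun n => (gaussian_moments (hm n) (h n)).2.1, fun n => (gaussian_moments (hm n) (h n)).2.2.1,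
      fun n => (gaussian_moments (hm n) (h n)).2.2.2⟩

end StandardSequences

section Khintchine

variable {Ω : Type*} [MeasurableSpace Ω] {P : Measure Ω}

/-- Even moments of a subgaussian variable, from `x^{2k}/(2k)! ≤ e^x + e^{-x}`. -/
theorem integral_pow_le_of_subgaussian [IsProbabilityMeasure P] {Z : Ω → ℝ} {c : NNReal}
    (h : HasSubgaussianMGF Z c P)
    (k : ℕ) : Integrable (fun ω => Z ω ^ (2 * k)) P ∧
      ∫ ω, Z ω ^ (2 * k) ∂P ≤ 2 * (2 * k).factorial * Real.exp (1 / 2) * (c : ℝ) ^ k := by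
  have hint : Integrable (fun ω => Z ω ^ (2 * k)) P := by
    refine ((h.memLp ((2 * k : ℕ) : NNReal)).integrable_norm_pow').congr
      (Filter.Eventually.of_forall fun ω => ?_)
    have : ((((2 * k : ℕ) : NNReal) : ℝ≥0∞)).toReal = ((2 * k : ℕ) : ℝ) := by simp
    simp [pow_mul]
  refine ⟨hint, ?_⟩
  rcases eq_or_ne c 0 with rfl | hc
  · have h0 := h.ae_eq_zero_of_hasSubgaussianMGF_zero
    have : (fun ω => Z ω ^ (2 * k)) =ᵐ[P] fun _ => (0 : ℝ) ^ (2 * k) :=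
      h0.mono fun ω hω => by simp [hω]
    rw [integral_congr_ae this]
    simp only [integral_const, probReal_univ, one_smul, NNReal.coe_zero]
    rcases Nat.eq_zero_or_pos k with rfl | hk
    · have := Real.add_one_le_exp (1 / 2)
      norm_num at this ⊢
      linarith
    · rw [zero_pow (by omega), zero_pow (by omega), mul_zero]
  · have hcpos : (0 : ℝ) < c := by exact_mod_cast pos_iff_ne_zero.2 hc
    -- At `±s` the subgaussian bound on the moment generating function is `exp (1 / 2)`.
    set s : ℝ := (Real.sqrt c)⁻¹ with hs
    have hs2 : s ^ 2 = (c : ℝ)⁻¹ := by rw [hs, inv_pow, Real.sq_sqrt hcpos.le]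
    have hpt : ∀ x : ℝ, x ^ (2 * k) ≤
        (2 * k).factorial * (c : ℝ) ^ k * (Real.exp (s * x) + Real.exp (-s * x)) := by
      intro x
      have h1 : |s * x| ^ (2 * k) / (2 * k).factorial ≤ Real.exp |s * x| :=
        Real.pow_div_factorial_le_exp _ (abs_nonneg _) _
      have h2 : Real.exp |s * x| ≤ Real.exp (s * x) + Real.exp (-s * x) := by
        rcases abs_cases (s * x) with ⟨h, -⟩ | ⟨h, -⟩ <;> rw [h]
        · linarith [Real.exp_pos (-s * x)]
        · rw [← neg_mul]; linarith [Real.exp_pos (s * x)]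
      have h3 : |s * x| ^ (2 * k) = ((c : ℝ) ^ k)⁻¹ * x ^ (2 * k) := by
        rw [pow_mul, sq_abs, mul_pow, hs2, mul_pow, inv_pow, ← pow_mul]
      rw [h3, div_le_iff₀ (by positivity)] at h1
      have hck : (0 : ℝ) < (c : ℝ) ^ k := by positivity
      calc x ^ (2 * k) = (c : ℝ) ^ k * (((c : ℝ) ^ k)⁻¹ * x ^ (2 * k)) := by field_simp
        _ ≤ (c : ℝ) ^ k * ((Real.exp (s * x) + Real.exp (-s * x)) * (2 * k).factorial) := by
          refine mul_le_mul_of_nonneg_left (h1.trans ?_) hck.le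
          gcongr
        _ = _ := by ring
    have hm : ∀ t : ℝ, t ^ 2 = (c : ℝ)⁻¹ → ∫ ω, Real.exp (t * Z ω) ∂P ≤ Real.exp (1 / 2) := by
      intro t ht
      refine (h.mgf_le t).trans (Real.exp_le_exp.2 (le_of_eq ?_))
      rw [ht]
      field_simp
    have hi : ∀ t, Integrable (fun ω => Real.exp (t * Z ω)) P := h.integrable_exp_mul
    calc ∫ ω, Z ω ^ (2 * k) ∂P ≤ ∫ ω, (2 * k).factorial * (c : ℝ) ^ k *
          (Real.exp (s * Z ω) + Real.exp (-s * Z ω)) ∂P :=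
          integral_mono hint (((hi s).add (hi (-s))).const_mul _) fun ω => hpt _
      _ = (2 * k).factorial * (c : ℝ) ^ k *
          (∫ ω, Real.exp (s * Z ω) ∂P + ∫ ω, Real.exp (-s * Z ω) ∂P) := by
          rw [integral_const_mul, integral_add (hi s) (hi (-s))]
      _ ≤ (2 * k).factorial * (c : ℝ) ^ k * (Real.exp (1 / 2) + Real.exp (1 / 2)) := by
          gcongr
          · exact hm s hs2
          · exact hm (-s) (by rw [neg_sq, hs2])
      _ = _ := by ring

variable {X : ℕ+ → Ω → ℂ}

/-- The constant in the Khintchine inequality of order `2k`. -/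
def khintchineConst (k : ℕ) : ℝ := 2 ^ k * (4 * (2 * k).factorial * Real.exp (1 / 2))

/-- Upper Khintchine inequality of even order. -/
theorem IsSubgaussianSeq.integral_norm_pow_le [IsProbabilityMeasure P]
    (hX : IsSubgaussianSeq X P) (k : ℕ)
    (T : Finset ℕ+) (c : ℕ+ → ℂ) :
    Integrable (fun ω => ‖∑ n ∈ T, c n * X n ω‖ ^ (2 * k)) P ∧
      ∫ ω, ‖∑ n ∈ T, c n * X n ω‖ ^ (2 * k) ∂P
        ≤ khintchineConst k * (∑ n ∈ T, ‖c n‖ ^ 2) ^ k := by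
  have hre : ∀ d : ℕ+ → ℂ, HasSubgaussianMGF (fun ω => (∑ n ∈ T, d n * X n ω).re)
      (∑ n ∈ T, ‖d n‖₊ ^ 2) P := by
    intro d
    have := HasSubgaussianMGF.sum_of_iIndepFun (X := fun n ω => (d n * X n ω).re) (s := T)
      (hX.indep.comp (fun n z => (d n * z).re) fun n => by fun_prop)
      (fun n _ => hX.subgaussian n (d n))
    simpa [Complex.re_sum] using this
  obtain ⟨hi1, hb1⟩ := integral_pow_le_of_subgaussian (hre c) k
  obtain ⟨hi2, hb2⟩ := integral_pow_le_of_subgaussian (hre fun n => -Complex.I * c n) k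
  have him : ∀ ω, (∑ n ∈ T, -Complex.I * c n * X n ω).re = (∑ n ∈ T, c n * X n ω).im := by
    intro ω
    simp_rw [mul_assoc]
    rw [← Finset.mul_sum]
    simp
  simp only [him] at hi2 hb2
  have hpt : ∀ z : ℂ, ‖z‖ ^ (2 * k) ≤ 2 ^ k * (z.re ^ (2 * k) + z.im ^ (2 * k)) := by
    intro z
    have h1 : ‖z‖ ^ 2 = z.re ^ 2 + z.im ^ 2 := by
      rw [← Complex.normSq_eq_norm_sq, Complex.normSq_apply]; ring
    have h2 := add_pow_le (sq_nonneg z.re) (sq_nonneg z.im) k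
    rw [← pow_mul, ← pow_mul] at h2
    rw [pow_mul, h1]
    refine h2.trans ?_
    have h3 : (0 : ℝ) ≤ z.re ^ (2 * k) + z.im ^ (2 * k) := by
      rw [pow_mul, pow_mul]; positivity
    gcongr
    · norm_num
    · omega
  have hmeas : Measurable fun ω => ∑ n ∈ T, c n * X n ω :=
    Finset.measurable_fun_sum _ fun n _ => (hX.measurable n).const_mul _
  have hdom := (hi1.add hi2).const_mul ((2 : ℝ) ^ k)
  have hint : Integrable (fun ω => ‖∑ n ∈ T, c n * X n ω‖ ^ (2 * k)) P := by
    refine hdom.mono' (hmeas.norm.pow_const _).aestronglyMeasurable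
      (Filter.Eventually.of_forall fun ω => ?_)
    rw [Real.norm_of_nonneg (by positivity)]
    exact hpt _
  refine ⟨hint, (integral_mono hint hdom fun ω => hpt _).trans ?_⟩
  simp only [Pi.add_apply]
  rw [integral_const_mul, integral_add hi1 hi2, khintchineConst, mul_assoc]
  push_cast at hb1 hb2
  simp only [norm_mul, norm_neg, Complex.norm_I, one_mul] at hb1 hb2
  refine mul_le_mul_of_nonneg_left ?_ (by positivity)
  linarith

theorem IsSubgaussianSeq.integral_mul_conj (hX : IsSubgaussianSeq X P) (n m : ℕ+) :
    Integrable (fun ω => X n ω * (starRingEnd ℂ) (X m ω)) P ∧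
      ∫ ω, X n ω * (starRingEnd ℂ) (X m ω) ∂P = if n = m then 1 else 0 := by
  have hconj : MemLp (fun ω => (starRingEnd ℂ) (X m ω)) 2 P := (hX.memLp_two m).star
  refine ⟨(hX.memLp_two n).integrable_mul hconj, ?_⟩
  split_ifs with h
  · subst h
    have e : ∀ ω, X n ω * (starRingEnd ℂ) (X n ω) = ((‖X n ω‖ ^ 2 : ℝ) : ℂ) := by
      intro ω
      rw [Complex.mul_conj, Complex.normSq_eq_norm_sq]
    simp_rw [e]
    rw [integral_complex_ofReal, hX.integral_norm_sq, Complex.ofReal_one]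
  · have hind : IndepFun (X n) (fun ω => (starRingEnd ℂ) (X m ω)) P :=
      (hX.indep.indepFun h).comp measurable_id (Complex.continuous_conj.measurable)
    rw [hind.integral_fun_mul_eq_mul_integral (hX.measurable n).aestronglyMeasurable
      hconj.aestronglyMeasurable, hX.integral_eq_zero, zero_mul]

theorem IsSubgaussianSeq.integral_norm_sq_sum (hX : IsSubgaussianSeq X P) (T : Finset ℕ+)
    (c : ℕ+ → ℂ) : ∫ ω, ‖∑ n ∈ T, c n * X n ω‖ ^ 2 ∂P = ∑ n ∈ T, ‖c n‖ ^ 2 := by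
  apply Complex.ofReal_injective
  rw [← integral_complex_ofReal]
  have e : ∀ ω, ((‖∑ n ∈ T, c n * X n ω‖ ^ 2 : ℝ) : ℂ) = ∑ n ∈ T, ∑ m ∈ T,
      (c n * (starRingEnd ℂ) (c m)) * (X n ω * (starRingEnd ℂ) (X m ω)) := by
    intro ω
    rw [← Complex.normSq_eq_norm_sq, ← Complex.mul_conj, map_sum, Finset.sum_mul_sum]
    refine Finset.sum_congr rfl fun n _ => Finset.sum_congr rfl fun m _ => ?_
    rw [map_mul]; ring
  simp_rw [e]
  rw [integral_finsetSum _ fun n _ => integrable_finsetSum _ fun m _ =>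
    (hX.integral_mul_conj n m).1.const_mul _]
  push_cast
  refine Finset.sum_congr rfl fun n hn => ?_
  rw [integral_finsetSum _ fun m _ => (hX.integral_mul_conj n m).1.const_mul _]
  simp_rw [integral_const_mul, (hX.integral_mul_conj n _).2]
  simp only [mul_ite, mul_one, mul_zero, Finset.sum_ite_eq, hn, if_true]
  rw [Complex.mul_conj, Complex.normSq_eq_norm_sq]
  push_cast
  rfl

theorem khintchineConst_pos (k : ℕ) : 0 < khintchineConst k := by
  unfold khintchineConst
  positivity

/-- Lower Khintchine inequality on a large event: if the complement of `B` has probability at most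
`1/(16 K)`, where `K` is the constant of order four, then the first moment over `B` still dominates
the standard deviation `σ`. It combines `z² ≤ λ z + z⁴/λ²` on `B` with `z² ≤ τ + z⁴/τ` off `B`, for
`λ² = τ = 4 K σ²`. -/
theorem IsSubgaussianSeq.le_setIntegral_norm [IsProbabilityMeasure P]
    (hX : IsSubgaussianSeq X P) (T : Finset ℕ+)
    (c : ℕ+ → ℂ) {B : Set Ω} (hB : MeasurableSet B)
    (hPB : P.real Bᶜ ≤ 1 / (16 * khintchineConst 2)) :
    Real.sqrt (∑ n ∈ T, ‖c n‖ ^ 2) ≤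
      8 * Real.sqrt (khintchineConst 2) * ∫ ω in B, ‖∑ n ∈ T, c n * X n ω‖ ∂P := by
  set V : ℝ := ∑ n ∈ T, ‖c n‖ ^ 2 with hV
  set K : ℝ := khintchineConst 2 with hK
  have hKpos : 0 < K := khintchineConst_pos 2
  set Z : Ω → ℝ := fun ω => ‖∑ n ∈ T, c n * X n ω‖ with hZ
  have hI0 : 0 ≤ ∫ ω in B, Z ω ∂P := integral_nonneg fun ω => norm_nonneg _
  have hV0 : 0 ≤ V := Finset.sum_nonneg fun n _ => by positivity
  rcases hV0.eq_or_lt with h0 | hVpos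
  · rw [← h0, Real.sqrt_zero]
    positivity
  have hZ0 : ∀ ω, 0 ≤ Z ω := fun ω => norm_nonneg _
  have hmeas : Measurable Z := (Finset.measurable_fun_sum _ fun n _ =>
    (hX.measurable n).const_mul _).norm
  have h2i : Integrable (fun ω => Z ω ^ 2) P := (hX.integral_norm_pow_le 1 T c).1
  have h4i : Integrable (fun ω => Z ω ^ 4) P := (hX.integral_norm_pow_le 2 T c).1
  have h4 : ∫ ω, Z ω ^ 4 ∂P ≤ K * V ^ 2 := (hX.integral_norm_pow_le 2 T c).2
  have h2 : ∫ ω, Z ω ^ 2 ∂P = V := hX.integral_norm_sq_sum T c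
  have h1i : Integrable Z P := by
    have : MemLp Z 2 P := (memLp_two_iff_integrable_sq hmeas.aestronglyMeasurable).2 h2i
    exact this.integrable one_le_two
  -- With this `τ` the fourth moment term `(K V²) / τ` and, for `P Bᶜ ≤ 1 / (16 K)`, the term
  -- `P Bᶜ * τ` are both at most `V / 4`, which leaves half of the second moment `V`.
  set τ : ℝ := 4 * K * V with hτ
  have hτpos : 0 < τ := by positivity
  set l : ℝ := Real.sqrt τ with hl
  have hlpos : 0 < l := Real.sqrt_pos.2 hτpos
  have hl2 : l ^ 2 = τ := Real.sq_sqrt hτpos.le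
  have hon : ∀ z : ℝ, 0 ≤ z → z ^ 2 ≤ l * z + z ^ 4 / τ := by
    intro z hz
    rw [← hl2]
    rcases le_total z l with h | h
    · have : 0 ≤ z ^ 4 / l ^ 2 := by positivity
      nlinarith
    · have : z ^ 2 ≤ z ^ 4 / l ^ 2 := by
        rw [le_div_iff₀ (by positivity)]
        have : l ^ 2 ≤ z ^ 2 := by gcongr
        nlinarith [sq_nonneg z]
      nlinarith
  have hoff : ∀ z : ℝ, z ^ 2 ≤ τ + z ^ 4 / τ := by
    intro z
    rw [← sub_nonneg]
    have : τ + z ^ 4 / τ - z ^ 2 = ((z ^ 2 - τ / 2) ^ 2 + 3 * τ ^ 2 / 4) / τ := by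
      field_simp
      ring
    rw [this]
    positivity
  have hsplit : ∫ ω in B, Z ω ^ 2 ∂P + ∫ ω in Bᶜ, Z ω ^ 2 ∂P = V := by
    rw [integral_add_compl hB h2i, h2]
  have h4split : ∫ ω in B, Z ω ^ 4 ∂P + ∫ ω in Bᶜ, Z ω ^ 4 ∂P ≤ K * V ^ 2 := by
    rwa [integral_add_compl hB h4i]
  have hBle : ∫ ω in B, Z ω ^ 2 ∂P ≤ l * ∫ ω in B, Z ω ∂P + (∫ ω in B, Z ω ^ 4 ∂P) / τ := by
    rw [← integral_const_mul, ← integral_div, ← integral_add (h1i.integrableOn.const_mul _)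
      (h4i.integrableOn.div_const _)]
    exact integral_mono h2i.integrableOn ((h1i.integrableOn.const_mul _).add
      (h4i.integrableOn.div_const _)) fun ω => hon _ (hZ0 ω)
  have hBcle : ∫ ω in Bᶜ, Z ω ^ 2 ∂P ≤ P.real Bᶜ * τ + (∫ ω in Bᶜ, Z ω ^ 4 ∂P) / τ := by
    have hc : ∫ ω in Bᶜ, τ ∂P = P.real Bᶜ * τ := by simp
    rw [← hc, ← integral_div, ← integral_add (integrable_const _) (h4i.integrableOn.div_const _)]
    exact integral_mono h2i.integrableOn ((integrable_const _).add
      (h4i.integrableOn.div_const _)) fun ω => hoff _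
  have hτ4 : (∫ ω in B, Z ω ^ 4 ∂P) / τ + (∫ ω in Bᶜ, Z ω ^ 4 ∂P) / τ ≤ V / 4 := by
    rw [← add_div, div_le_iff₀ hτpos, hτ]
    calc _ ≤ K * V ^ 2 := h4split
      _ = _ := by ring
  have hτB : P.real Bᶜ * τ ≤ V / 4 := by
    calc P.real Bᶜ * τ ≤ 1 / (16 * K) * τ := by gcongr
      _ = V / 4 := by rw [hτ]; field_simp; ring
  have hlow : V / 4 ≤ l * ∫ ω in B, Z ω ∂P := by linarith
  have hls : l = 2 * Real.sqrt K * Real.sqrt V := by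
    rw [hl, hτ, Real.sqrt_mul (by positivity), Real.sqrt_mul (by positivity)]
    congr 2
    rw [show (4 : ℝ) = 2 ^ 2 by norm_num, Real.sqrt_sq (by norm_num)]
  have hsV : 0 < Real.sqrt V := Real.sqrt_pos.2 hVpos
  rw [hls] at hlow
  have hVV : V = Real.sqrt V * Real.sqrt V := (Real.mul_self_sqrt hV0).symm
  refine le_of_mul_le_mul_right ?_ hsV
  nlinarith

end Khintchine

/-! ### Randomization -/

/-- The integral mean `∫ |∑_{n ∈ T} b_n w^{α(n)}|^q dm_∞(w)` of a polynomial. -/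
def torusMean (q : ℕ) (T : Finset ℕ+) (b : ℕ+ → ℂ) : ℝ≥0∞ :=
  ∫⁻ t, ‖∑ n ∈ T, b n * monomial n fun j => circlePoint (t j)‖ₑ ^ q ∂torusMeasure

theorem measurable_sum_mul_monomial {Ω : Type*} [MeasurableSpace Ω] {T : Finset ℕ+}
    {Y : Ω → ℕ+ → ℂ} (h : ∀ n ∈ T, Measurable fun ω => Y ω n) :
    Measurable fun p : Ω × Torus => ∑ n ∈ T, Y p.1 n * monomial n fun j => circlePoint (p.2 j) :=
  Finset.measurable_fun_sum _ fun n hn => ((h n hn).comp measurable_fst).mul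
    ((continuous_monomial_circlePoint n).measurable.comp measurable_snd)

theorem measurable_torusMean {Ω : Type*} [MeasurableSpace Ω] (q : ℕ) {T : Finset ℕ+}
    {Y : Ω → ℕ+ → ℂ} (h : ∀ n ∈ T, Measurable fun ω => Y ω n) :
    Measurable fun ω => torusMean q T (Y ω) :=
  ((measurable_sum_mul_monomial h).enorm.pow_const q).lintegral_prod_right'

theorem enorm_mul_monomial_circlePoint (z : ℂ) (n : ℕ+) (t : Torus) :
    ‖z * monomial n fun j => circlePoint (t j)‖ₑ = ‖z‖ₑ := by
  rw [← ofReal_norm, norm_mul, norm_monomial_circlePoint, mul_one, ofReal_norm]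

theorem torusMean_one_le_add {T T' : Finset ℕ+} (h : T' ⊆ T) (b : ℕ+ → ℂ) :
    torusMean 1 T b ≤ torusMean 1 T' b + ∑ n ∈ T \ T', ‖b n‖ₑ := by
  calc torusMean 1 T b
      ≤ ∫⁻ t, ‖∑ n ∈ T', b n * monomial n fun j => circlePoint (t j)‖ₑ ^ 1
          + ∑ n ∈ T \ T', ‖b n‖ₑ ∂torusMeasure := by
        refine lintegral_mono fun t => ?_
        simp only [pow_one]
        rw [← Finset.sum_sdiff h, add_comm]
        refine (enorm_add_le _ _).trans (add_le_add_right ((enorm_sum_le _ _).trans ?_) _)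
        exact Finset.sum_le_sum fun n _ => (enorm_mul_monomial_circlePoint _ _ _).le
    _ = _ := by
        rw [lintegral_add_right _ measurable_const]
        simp [torusMean]

theorem torusMean_one_le_add_of_subset {T T' : Finset ℕ+} (h : T' ⊆ T) (b : ℕ+ → ℂ) :
    torusMean 1 T' b ≤ torusMean 1 T b + ∑ n ∈ T \ T', ‖b n‖ₑ := by
  calc torusMean 1 T' b
      ≤ ∫⁻ t, ‖∑ n ∈ T, b n * monomial n fun j => circlePoint (t j)‖ₑ ^ 1
          + ∑ n ∈ T \ T', ‖b n‖ₑ ∂torusMeasure := by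
        refine lintegral_mono fun t => ?_
        simp only [pow_one]
        rw [← add_sub_cancel_left (∑ n ∈ T \ T', b n * monomial n fun j => circlePoint (t j))
          (∑ n ∈ T', b n * monomial n fun j => circlePoint (t j)), Finset.sum_sdiff h]
        refine enorm_sub_le.trans (add_le_add_right ((enorm_sum_le _ _).trans ?_) _)
        exact Finset.sum_le_sum fun n _ => (enorm_mul_monomial_circlePoint _ _ _).le
    _ = _ := by
        rw [lintegral_add_right _ measurable_const]
        simp [torusMean]

theorem HasMonomialExpansion.tendsto_torusMean {G : Ell1 → ℂ} {b : ℕ+ → ℂ}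
    (h : HasMonomialExpansion G b) (r : Ioo (0 : ℝ) 1) (q : ℕ) {ι : Type*} {l : Filter ι}
    [l.IsCountablyGenerated] {T : ι → Finset ℕ+} (hT : Filter.Tendsto T l Filter.atTop) :
    Filter.Tendsto
      (fun m => torusMean q (T m) fun n => b n * (dilationWeight r n : ℂ)) l
      (𝓝 (∫⁻ t, ‖dilate G r t‖ₑ ^ q ∂torusMeasure)) := by
  have hs := h.summable_dilationWeight r
  set U : ℝ≥0∞ := ∑' n, ‖b n * (dilationWeight r n : ℂ)‖ₑ with hU
  have hUtop : U ≠ ∞ := by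
    rw [hU, ← tsum_congr fun n => ofReal_norm _]
    exact hs.tsum_ofReal_ne_top
  refine tendsto_lintegral_filter_of_dominated_convergence (fun _ => U ^ q)
    (Filter.Eventually.of_forall fun m => ?_) (Filter.Eventually.of_forall fun m =>
      Filter.Eventually.of_forall fun t => ?_) ?_ (Filter.Eventually.of_forall fun t => ?_)
  · exact (Continuous.enorm (continuous_finsetSum _ fun n _ => continuous_const.mul
      (continuous_monomial_circlePoint n))).measurable.pow_const q
  · refine pow_le_pow_left₀ zero_le ((enorm_sum_le _ _).trans ?_) q
    refine le_trans (Finset.sum_le_sum fun n _ => ?_) (ENNReal.sum_le_tsum (T m))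
    exact (enorm_mul_monomial_circlePoint _ _ _).le
  · simp [hUtop]
  · have h1 := (h.hasSum_dilate r t).comp hT
    exact ((ENNReal.continuous_pow q).tendsto _).comp ((continuous_enorm.tendsto _).comp h1)

section Randomization

variable {Ω : Type*} [MeasurableSpace Ω] {P : Measure Ω} {X : ℕ+ → Ω → ℂ}

theorem norm_mul_monomial_circlePoint (z : ℂ) (n : ℕ+) (t : Torus) :
    ‖z * monomial n fun j => circlePoint (t j)‖ = ‖z‖ := by
  rw [norm_mul, norm_monomial_circlePoint, mul_one]

theorem lintegral_torusMean [IsProbabilityMeasure P] (hX : ∀ n, Measurable (X n)) (q : ℕ)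
    (T : Finset ℕ+) (c : ℕ+ → ℂ) (B : Set Ω) :
    ∫⁻ ω in B, torusMean q T (fun n => c n * X n ω) ∂P = ∫⁻ t, ∫⁻ ω in B,
      ‖∑ n ∈ T, (c n * monomial n fun j => circlePoint (t j)) * X n ω‖ₑ ^ q ∂P ∂torusMeasure := by
  simp only [torusMean]
  rw [lintegral_lintegral_swap]
  · refine lintegral_congr fun t => lintegral_congr fun ω => ?_
    congr 2
    exact Finset.sum_congr rfl fun n _ => by ring
  · exact ((measurable_sum_mul_monomial fun n _ =>
      (hX n).const_mul (c n)).enorm.pow_const q).aemeasurable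

theorem IsSubgaussianSeq.lintegral_torusMean_le [IsProbabilityMeasure P]
    (hX : IsSubgaussianSeq X P) (k : ℕ) (T : Finset ℕ+) (c : ℕ+ → ℂ) :
    ∫⁻ ω, torusMean (2 * k) T (fun n => c n * X n ω) ∂P
      ≤ ENNReal.ofReal (khintchineConst k * (∑ n ∈ T, ‖c n‖ ^ 2) ^ k) := by
  have h := lintegral_torusMean (P := P) hX.measurable (2 * k) T c univ
  simp only [Measure.restrict_univ] at h
  rw [h]
  calc _ ≤ ∫⁻ _, ENNReal.ofReal (khintchineConst k * (∑ n ∈ T, ‖c n‖ ^ 2) ^ k) ∂torusMeasure := by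
        refine lintegral_mono fun t => ?_
        obtain ⟨hi, hb⟩ := hX.integral_norm_pow_le k T
          fun n => c n * monomial n fun j => circlePoint (t j)
        simp only [norm_mul_monomial_circlePoint] at hb
        refine le_trans (le_of_eq ?_) (ENNReal.ofReal_le_ofReal hb)
        rw [ofReal_integral_eq_lintegral_ofReal hi
          (Filter.Eventually.of_forall fun ω => by positivity)]
        refine lintegral_congr fun ω => ?_
        rw [ENNReal.ofReal_pow (norm_nonneg _), ofReal_norm]
    _ = _ := by simp

/-- If the `L¹` means of a random polynomial are at most `M` with probability close to one, then the
square sum of its coefficients is bounded in terms of `M`. -/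
theorem IsSubgaussianSeq.sqrt_sum_le [IsProbabilityMeasure P] (hX : IsSubgaussianSeq X P)
    (T : Finset ℕ+) (c : ℕ+ → ℂ) {B : Set Ω} (hB : MeasurableSet B)
    (hPB : P.real Bᶜ ≤ 1 / (16 * khintchineConst 2)) {M : ℝ} (hM : 0 ≤ M)
    (hBM : ∀ ω ∈ B, torusMean 1 T (fun n => c n * X n ω) ≤ ENNReal.ofReal M) :
    Real.sqrt (∑ n ∈ T, ‖c n‖ ^ 2) ≤ 8 * Real.sqrt (khintchineConst 2) * M := by
  set L : ℝ := 8 * Real.sqrt (khintchineConst 2) with hL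
  have hL0 : 0 ≤ L := by positivity
  have hpt : ∀ t : Torus, ENNReal.ofReal (Real.sqrt (∑ n ∈ T, ‖c n‖ ^ 2)) ≤ ENNReal.ofReal L *
      ∫⁻ ω in B, ‖∑ n ∈ T, (c n * monomial n fun j => circlePoint (t j)) * X n ω‖ₑ ^ 1 ∂P := by
    intro t
    have h := hX.le_setIntegral_norm T (fun n => c n * monomial n fun j => circlePoint (t j)) hB hPB
    simp only [norm_mul_monomial_circlePoint] at h
    refine (ENNReal.ofReal_le_ofReal h).trans ?_
    rw [ENNReal.ofReal_mul hL0]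
    gcongr
    simp only [pow_one]
    rw [integral_norm_eq_lintegral_enorm]
    · exact ENNReal.ofReal_toReal_le
    · exact (Finset.measurable_fun_sum _ fun n _ =>
        (hX.measurable n).const_mul _).aestronglyMeasurable
  have hmain : ENNReal.ofReal (Real.sqrt (∑ n ∈ T, ‖c n‖ ^ 2)) ≤ ENNReal.ofReal (L * M) := by
    calc ENNReal.ofReal (Real.sqrt (∑ n ∈ T, ‖c n‖ ^ 2))
        = ∫⁻ _, ENNReal.ofReal (Real.sqrt (∑ n ∈ T, ‖c n‖ ^ 2)) ∂torusMeasure := by simp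
      _ ≤ ∫⁻ t, ENNReal.ofReal L * ∫⁻ ω in B,
          ‖∑ n ∈ T, (c n * monomial n fun j => circlePoint (t j)) * X n ω‖ₑ ^ 1 ∂P
            ∂torusMeasure := lintegral_mono hpt
      _ = ENNReal.ofReal L * ∫⁻ ω in B, torusMean 1 T (fun n => c n * X n ω) ∂P := by
          rw [lintegral_const_mul' _ _ ENNReal.ofReal_ne_top,
            lintegral_torusMean hX.measurable 1 T c B]
      _ ≤ ENNReal.ofReal L * ∫⁻ ω in B, ENNReal.ofReal M ∂P := by
          gcongr ENNReal.ofReal L * ?_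
          exact setLIntegral_mono measurable_const hBM
      _ ≤ ENNReal.ofReal L * ENNReal.ofReal M := by
          gcongr
          rw [setLIntegral_const]
          exact mul_le_of_le_one_right zero_le prob_le_one
      _ = _ := (ENNReal.ofReal_mul hL0).symm
  exact (ENNReal.ofReal_le_ofReal_iff (by positivity)).1 hmain

theorem summable_norm_sq_of_tsum_lt_top {b : ℕ+ → ℂ} (h : ∑' n, ‖b n‖ₑ ^ 2 < ∞) :
    Summable fun n => ‖b n‖ ^ 2 := by
  refine (ENNReal.summable_toReal h.ne).congr fun n => ?_
  rw [ENNReal.toReal_pow, toReal_enorm]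

theorem IsSubgaussianSeq.ae_summable_norm_sq (hX : IsSubgaussianSeq X P) {a : ℕ+ → ℂ}
    (ha : ∑' n, ‖a n‖ₑ ^ 2 < ∞) : ∀ᵐ ω ∂P, Summable fun n => ‖a n * X n ω‖ ^ 2 := by
  have hm : ∀ n, Measurable fun ω => ‖a n * X n ω‖ₑ ^ 2 := fun n =>
    ((hX.measurable n).const_mul _).enorm.pow_const 2
  have hE : ∫⁻ ω, ∑' n, ‖a n * X n ω‖ₑ ^ 2 ∂P = ∑' n, ‖a n‖ₑ ^ 2 := by
    rw [lintegral_tsum fun n => (hm n).aemeasurable]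
    refine tsum_congr fun n => ?_
    simp_rw [enorm_mul, mul_pow]
    rw [lintegral_const_mul' _ _ (by finiteness)]
    have : ∫⁻ ω, ‖X n ω‖ₑ ^ 2 ∂P = 1 := by
      have h := ofReal_integral_eq_lintegral_ofReal (hX.integrable_norm_sq n)
        (Filter.Eventually.of_forall fun ω => by positivity)
      rw [hX.integral_norm_sq, ENNReal.ofReal_one] at h
      rw [h]
      refine lintegral_congr fun ω => ?_
      rw [ENNReal.ofReal_pow (norm_nonneg _), ofReal_norm]
    rw [this, mul_one]
  have := ae_lt_top (Measurable.tsum hm) (by rw [hE]; exact ha.ne)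
  exact this.mono fun ω hω => summable_norm_sq_of_tsum_lt_top hω

/-- Square summable coefficients: the randomization is almost surely in every `H^p`. -/
theorem IsSubgaussianSeq.ae_seriesMemHardy [IsProbabilityMeasure P] (hX : IsSubgaussianSeq X P)
    {a : ℕ+ → ℂ} (ha : ∑' n, ‖a n‖ₑ ^ 2 < ∞) {p : ℝ} (hp : 0 ≤ p) :
    ∀ᵐ ω ∂P, SeriesMemHardy p fun n => a n * X n ω := by
  obtain ⟨k, hk⟩ := exists_nat_ge p
  have hpk : p ≤ (2 * k : ℕ) := by
    push_cast
    linarith [Nat.cast_nonneg (α := ℝ) k]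
  have hsq := summable_norm_sq_of_tsum_lt_top ha
  set V : ℝ := ∑' n, ‖a n‖ ^ 2 with hV
  obtain ⟨T, hT⟩ := Filter.exists_seq_tendsto (Filter.atTop : Filter (Finset ℕ+))
  let Q : ℕ → ℕ → Ω → ℝ≥0∞ := fun i m ω => torusMean (2 * k) (T m)
    fun n => a n * X n ω * (dilationWeight (radius i) n : ℂ)
  have hQm : ∀ i m, Measurable (Q i m) := fun i m =>
    measurable_torusMean _ fun n _ => ((hX.measurable n).const_mul _).mul_const _
  have hQ : ∀ i m, ∫⁻ ω, Q i m ω ∂P ≤ ENNReal.ofReal (khintchineConst k * V ^ k) := by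
    intro i m
    have h := hX.lintegral_torusMean_le k (T m)
      fun n => a n * (dilationWeight (radius i) n : ℂ)
    simp_rw [mul_right_comm (a _) _ (X _ _)] at h
    refine h.trans (ENNReal.ofReal_le_ofReal ?_)
    refine mul_le_mul_of_nonneg_left (pow_le_pow_left₀
      (Finset.sum_nonneg fun n _ => by positivity) ?_ k) (khintchineConst_pos k).le
    refine le_trans (Finset.sum_le_sum fun n _ => ?_)
      (hsq.sum_le_tsum (T m) fun n _ => by positivity)
    rw [norm_mul, Complex.norm_real,
      Real.norm_of_nonneg (dilationWeight_nonneg (radius i).2.1.le n)]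
    refine pow_le_pow_left₀ (mul_nonneg (norm_nonneg _)
      (dilationWeight_nonneg (radius i).2.1.le n)) ?_ 2
    exact mul_le_of_le_one_right (norm_nonneg _)
      (dilationWeight_le_one (radius i).2.1.le (radius i).2.2.le n)
  -- Almost surely this is the `2k`-th power mean, at `radius i`, of the sum of the random series;
  -- as a lower limit it is measurable in `ω`, and Fatou's lemma applies.
  let H : ℕ → Ω → ℝ≥0∞ := fun i ω => Filter.liminf (fun m => Q i m ω) Filter.atTop
  have hHm : ∀ i, Measurable (H i) := fun i => Measurable.liminf fun m => hQm i m
  have hH : ∀ i, ∫⁻ ω, H i ω ∂P ≤ ENNReal.ofReal (khintchineConst k * V ^ k) := fun i =>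
    (lintegral_liminf_le fun m => hQm i m).trans
      (Filter.liminf_le_of_le (by isBoundedDefault) fun b hb => by
        obtain ⟨m, hm⟩ := hb.exists
        exact hm.trans (hQ i m))
  have hHG : ∀ ω, ∀ G, HasMonomialExpansion G (fun n => a n * X n ω) → ∀ i,
      H i ω = ∫⁻ t, ‖dilate G (radius i) t‖ₑ ^ (2 * k) ∂torusMeasure :=
    fun ω G hG i => (hG.tendsto_torusMean (radius i) (2 * k) hT).liminf_eq
  have hae := hX.ae_summable_norm_sq ha
  have hmono : ∀ᵐ ω ∂P, Monotone fun i => H i ω := by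
    filter_upwards [hae] with ω hω
    obtain ⟨G, hG, hGe⟩ := exists_analytic_of_summable_sq hω
    intro i j hij
    simp only [hHG ω G hGe]
    exact hG.lintegral_dilate_even_mono k (monotone_radius hij)
  have hsup : ∫⁻ ω, ⨆ i, H i ω ∂P ≤ ENNReal.ofReal (khintchineConst k * V ^ k) := by
    rw [lintegral_iSup' (fun i => (hHm i).aemeasurable) hmono]
    exact iSup_le hH
  have hfin := ae_lt_top (Measurable.iSup hHm) (hsup.trans_lt ENNReal.ofReal_lt_top).ne
  filter_upwards [hae, hfin] with ω hω hωfin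
  obtain ⟨G, hG, hGe⟩ := exists_analytic_of_summable_sq hω
  refine ⟨G, ⟨hG, (hardyNormPow_le_one_add G hp hpk).trans_lt ?_⟩, hGe⟩
  refine ENNReal.add_lt_top.2 ⟨ENNReal.one_lt_top, lt_of_le_of_lt (iSup_le fun r => ?_) hωfin⟩
  obtain ⟨i, hi⟩ := exists_le_radius r
  simp_rw [ENNReal.rpow_natCast]
  refine (hG.lintegral_dilate_even_mono k hi).trans ?_
  rw [← hHG ω G hGe]
  exact le_iSup (fun i => H i ω) i

/-- The event that, for some `M`, along every radius the `L¹` means of the partial sums of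
`∑_{n ≥ N} b_n r^{...} w^{α(n)}` are eventually at most `M`. -/
def boundedMeansEvent {Ω : Type*} (a : ℕ+ → ℂ) (X : ℕ+ → Ω → ℂ) (N : ℕ+) : Set Ω :=
  {ω | ∃ M : ℕ, ∀ i : ℕ, ∃ m₀ : ℕ+, ∀ m : ℕ+, m₀ ≤ m →
    torusMean 1 (Finset.Icc N m) (fun n => a n * (dilationWeight (radius i) n : ℂ) * X n ω) ≤ M}

theorem boundedMeansEvent_eq {Ω : Type*} (a : ℕ+ → ℂ) (X : ℕ+ → Ω → ℂ) (N : ℕ+) :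
    boundedMeansEvent a X N = boundedMeansEvent a X 1 := by
  ext ω
  have hsub : ∀ m, Finset.Icc N m ⊆ Finset.Icc 1 m := fun m =>
    Finset.Icc_subset_Icc_left (one_le)
  have hN : ∀ m, Finset.Icc 1 m \ Finset.Icc N m ⊆ Finset.Iio N := by
    intro m n hn
    simp only [Finset.mem_sdiff, Finset.mem_Icc, Finset.mem_Iio] at hn ⊢
    by_contra h
    exact hn.2 ⟨not_lt.1 h, hn.1.2⟩
  have hle : ∀ (i : ℕ) (n : ℕ+),
      ‖a n * (dilationWeight (radius i) n : ℂ) * X n ω‖ₑ ≤ ‖a n * X n ω‖ₑ := by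
    intro i n
    rw [enorm_le_iff_norm_le, norm_mul, norm_mul, norm_mul, Complex.norm_real,
      Real.norm_of_nonneg (dilationWeight_nonneg (radius i).2.1.le n)]
    gcongr
    exact mul_le_of_le_one_right (norm_nonneg _)
      (dilationWeight_le_one (radius i).2.1.le (radius i).2.2.le n)
  obtain ⟨C, hC⟩ : ∃ C : ℕ, ∑ n ∈ Finset.Iio N, ‖a n * X n ω‖ₑ ≤ C := by
    obtain ⟨C, hC⟩ := ENNReal.exists_nat_gt (r := ∑ n ∈ Finset.Iio N, ‖a n * X n ω‖ₑ)
      (ENNReal.sum_ne_top.2 fun n _ => enorm_ne_top)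
    exact ⟨C, hC.le⟩
  have hdiff : ∀ i m, ∑ n ∈ Finset.Icc 1 m \ Finset.Icc N m,
      ‖a n * (dilationWeight (radius i) n : ℂ) * X n ω‖ₑ ≤ C := fun i m =>
    (Finset.sum_le_sum fun n _ => hle i n).trans
      ((Finset.sum_le_sum_of_subset (hN m)).trans hC)
  constructor
  · rintro ⟨M, hM⟩
    refine ⟨M + C, fun i => ?_⟩
    obtain ⟨m₀, hm₀⟩ := hM i
    refine ⟨m₀, fun m hm => (torusMean_one_le_add (hsub m) _).trans ?_⟩
    push_cast
    exact add_le_add (hm₀ m hm) (hdiff i m)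
  · rintro ⟨M, hM⟩
    refine ⟨M + C, fun i => ?_⟩
    obtain ⟨m₀, hm₀⟩ := hM i
    refine ⟨m₀, fun m hm => ?_⟩
    push_cast
    refine le_trans ?_ (add_le_add (hm₀ m hm) (hdiff i m))
    exact torusMean_one_le_add_of_subset (hsub m) _

theorem measurableSet_boundedMeansEvent {Ω : Type*} [MeasurableSpace Ω] (a : ℕ+ → ℂ)
    {X : ℕ+ → Ω → ℂ} {N : ℕ+} (hX : ∀ n, N ≤ n → Measurable (X n)) :
    MeasurableSet (boundedMeansEvent a X N) := by
  have e : boundedMeansEvent a X N = ⋃ M : ℕ, ⋂ i : ℕ, ⋃ m₀ : ℕ+, ⋂ m : ℕ+, ⋂ _ : m₀ ≤ m,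
      {ω | torusMean 1 (Finset.Icc N m)
        (fun n => a n * (dilationWeight (radius i) n : ℂ) * X n ω) ≤ M} := by
    ext ω
    simp [boundedMeansEvent]
  rw [e]
  refine MeasurableSet.iUnion fun M => MeasurableSet.iInter fun i => MeasurableSet.iUnion fun m₀ =>
    MeasurableSet.iInter fun m => MeasurableSet.iInter fun _ =>
      measurableSet_le (measurable_torusMean 1 fun n hn => ?_) measurable_const
  exact (hX n (Finset.mem_Icc.1 hn).1).const_mul _

/-- Kolmogorov's zero-one law for the event of bounded means, which does not depend on finitely many
of the random variables. -/
theorem IsSubgaussianSeq.boundedMeansEvent_zero_or_one (hX : IsSubgaussianSeq X P) (a : ℕ+ → ℂ) :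
    P (boundedMeansEvent a X 1) = 0 ∨ P (boundedMeansEvent a X 1) = 1 := by
  refine measure_zero_or_one_of_measurableSet_limsup_atTop
    (s := fun n => MeasurableSpace.comap (X n) inferInstance)
    (fun n => (hX.measurable n).comap_le) hX.indep ?_
  rw [Filter.atTop_basis.limsup_eq_iInf_iSup]
  simp only [MeasurableSpace.measurableSet_iInf]
  intro N _
  rw [← boundedMeansEvent_eq a X N]
  refine @measurableSet_boundedMeansEvent Ω
    (⨆ n ∈ Ici N, MeasurableSpace.comap (X n) inferInstance) a X N fun n hn => ?_
  refine Measurable.mono (comap_measurable (X n)) ?_ le_rfl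
  exact le_iSup₂_of_le n hn le_rfl

theorem mem_boundedMeansEvent {Ω : Type*} {X : ℕ+ → Ω → ℂ} {a : ℕ+ → ℂ} {ω : Ω} {p : ℝ} (hp : 1 ≤ p)
    (h : SeriesMemHardy p fun n => a n * X n ω) : ω ∈ boundedMeansEvent a X 1 := by
  obtain ⟨G, hG, hGe⟩ := h
  have h1 : hardyNormPow 1 G < ∞ := (hardyNormPow_le_one_add G zero_le_one hp).trans_lt
    (ENNReal.add_lt_top.2 ⟨ENNReal.one_lt_top, hG.2⟩)
  obtain ⟨M, hM⟩ := ENNReal.exists_nat_gt h1.ne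
  refine ⟨M, fun i => ?_⟩
  have hlt : ∫⁻ t, ‖dilate G (radius i) t‖ₑ ^ 1 ∂torusMeasure < M := by
    refine lt_of_le_of_lt ?_ hM
    have := le_iSup (fun r : Ioo (0 : ℝ) 1 => ∫⁻ t, ‖dilate G r t‖ₑ ^ (1 : ℝ) ∂torusMeasure)
      (radius i)
    simpa [hardyNormPow] using this
  obtain ⟨m₀, hm₀⟩ := Filter.eventually_atTop.1
    ((hGe.tendsto_torusMean (radius i) 1 Filter.tendsto_finset_Iic_atTop_atTop).eventually
      (gt_mem_nhds hlt))
  refine ⟨m₀, fun m hm => ?_⟩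
  have e : Finset.Icc 1 m = Finset.Iic m := by
    ext n
    simp
  rw [e]
  simp_rw [mul_right_comm (a _) _ (X _ _)]
  exact (hm₀ m hm).le

theorem exists_measure_gt_of_monotone {ι : Type*} [Preorder ι] [IsDirectedOrder ι]
    [Nonempty ι] [(Filter.atTop : Filter ι).IsCountablyGenerated] {s : ι → Set Ω}
    (hs : Monotone s) {x : ℝ≥0∞} (hx : x < P (⋃ i, s i)) : ∃ i, x < P (s i) := by
  rw [hs.measure_iUnion] at hx
  exact lt_iSup_iff.1 hx

/-- If the means are bounded almost surely, then the coefficients are square summable. -/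
theorem IsSubgaussianSeq.tsum_lt_top_of_boundedMeans [IsProbabilityMeasure P]
    (hX : IsSubgaussianSeq X P) {a : ℕ+ → ℂ} (h : P (boundedMeansEvent a X 1) = 1) :
    ∑' n, ‖a n‖ₑ ^ 2 < ∞ := by
  set K : ℝ := khintchineConst 2 with hK
  have hKpos : 0 < K := khintchineConst_pos 2
  set ε : ℝ := 1 / (16 * K) with hε
  have hεpos : 0 < ε := by positivity
  let Y : ℕ → ℕ+ → Ω → ℝ≥0∞ := fun i m ω => torusMean 1 (Finset.Icc 1 m)
    fun n => a n * (dilationWeight (radius i) n : ℂ) * X n ω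
  have hYm : ∀ i m, Measurable (Y i m) := fun i m =>
    measurable_torusMean 1 fun n _ => (hX.measurable n).const_mul _
  -- The event is the increasing union of the `A M`, and at a fixed radius `A M` lies in the
  -- increasing union over `m₀` of the sets `D m₀` below; so one `M` serves for all radii, with
  -- `m₀` depending on the radius.
  let A : ℕ → Set Ω := fun M => {ω | ∀ i : ℕ, ∃ m₀ : ℕ+, ∀ m, m₀ ≤ m → Y i m ω ≤ M}
  have hA : Monotone A := by
    intro M M' hMM ω hω i
    obtain ⟨m₀, hm₀⟩ := hω i
    exact ⟨m₀, fun m hm => (hm₀ m hm).trans (by exact_mod_cast hMM)⟩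
  have hlt : (1 : ℝ≥0∞) - ENNReal.ofReal ε < 1 :=
    ENNReal.sub_lt_self ENNReal.one_ne_top one_ne_zero (by simpa using hεpos)
  obtain ⟨M, hM⟩ : ∃ M, 1 - ENNReal.ofReal ε < P (A M) := by
    refine exists_measure_gt_of_monotone hA ?_
    have e : ⋃ M, A M = boundedMeansEvent a X 1 := by
      ext ω
      simp [A, boundedMeansEvent, Y]
    rw [e, h]
    exact hlt
  have hbound : ∀ i, ∃ m₀ : ℕ+, ∀ m, m₀ ≤ m → Real.sqrt (∑ n ∈ Finset.Icc 1 m,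
      ‖a n * (dilationWeight (radius i) n : ℂ)‖ ^ 2) ≤ 8 * Real.sqrt K * M := by
    intro i
    let D : ℕ+ → Set Ω := fun m₀ => {ω | ∀ m, m₀ ≤ m → Y i m ω ≤ M}
    have hD : Monotone D := fun m m' hmm ω hω k hk => hω k (hmm.trans hk)
    have hDm : ∀ m₀, MeasurableSet (D m₀) := by
      intro m₀
      have e : D m₀ = ⋂ m : ℕ+, ⋂ _ : m₀ ≤ m, {ω | Y i m ω ≤ M} := by
        ext ω
        simp [D]
      rw [e]
      exact MeasurableSet.iInter fun m => MeasurableSet.iInter fun _ =>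
        measurableSet_le (hYm i m) measurable_const
    obtain ⟨m₀, hm₀⟩ : ∃ m₀, 1 - ENNReal.ofReal ε < P (D m₀) := by
      refine exists_measure_gt_of_monotone hD (hM.trans_le (measure_mono fun ω hω => ?_))
      exact mem_iUnion.2 (hω i)
    refine ⟨m₀, fun m hm => ?_⟩
    refine hX.sqrt_sum_le (Finset.Icc 1 m) (fun n => a n * (dilationWeight (radius i) n : ℂ))
      (hDm m₀) ?_ (Nat.cast_nonneg M) fun ω hω => ?_
    · rw [measureReal_def, prob_compl_eq_one_sub (hDm m₀)]
      refine ENNReal.toReal_le_of_le_ofReal hεpos.le ?_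
      exact tsub_le_iff_tsub_le.1 hm₀.le
    · rw [ENNReal.ofReal_natCast]
      exact hω m hm
  have hsum : ∀ T : Finset ℕ+, ∑ n ∈ T, ‖a n‖ ^ 2 ≤ (8 * Real.sqrt K * M) ^ 2 := by
    intro T
    have hlim : Filter.Tendsto
        (fun i => ∑ n ∈ T, ‖a n * (dilationWeight (radius i) n : ℂ)‖ ^ 2) Filter.atTop
        (𝓝 (∑ n ∈ T, ‖a n‖ ^ 2)) := by
      refine tendsto_finsetSum _ fun n _ => ?_
      have h1 : Filter.Tendsto (fun i => a n * (dilationWeight (radius i) n : ℂ)) Filter.atTop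
          (𝓝 (a n)) := by
        simpa using ((Complex.continuous_ofReal.tendsto 1).comp
          (tendsto_dilationWeight_radius n)).const_mul (a n)
      exact h1.norm.pow 2
    refine le_of_tendsto' hlim fun i => ?_
    obtain ⟨m₀, hm₀⟩ := hbound i
    obtain ⟨m, hm, hTm⟩ : ∃ m, m₀ ≤ m ∧ T ⊆ Finset.Icc 1 m := by
      obtain ⟨m₁, hm₁⟩ := T.bddAbove
      exact ⟨max m₀ m₁, le_max_left _ _, fun n hn =>
        Finset.mem_Icc.2 ⟨one_le, (hm₁ hn).trans (le_max_right _ _)⟩⟩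
    refine (Finset.sum_le_sum_of_subset_of_nonneg hTm fun n _ _ => by positivity).trans ?_
    exact (Real.sqrt_le_left (by positivity)).1 (hm₀ m hm)
  have hs : Summable fun n => ‖a n‖ ^ 2 := summable_of_sum_le (fun n => by positivity) hsum
  have := hs.tsum_ofReal_lt_top
  refine lt_of_le_of_lt (le_of_eq (tsum_congr fun n => ?_)) this
  rw [ENNReal.ofReal_pow (norm_nonneg _), ofReal_norm]

/-- Coefficients that are not square summable: the randomization is almost surely in no `H^p`. -/
theorem IsSubgaussianSeq.ae_not_seriesMemHardy [IsProbabilityMeasure P]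
    (hX : IsSubgaussianSeq X P) {a : ℕ+ → ℂ} (ha : ¬ ∑' n, ‖a n‖ₑ ^ 2 < ∞) {p : ℝ} (hp : 1 ≤ p) :
    ∀ᵐ ω ∂P, ¬ SeriesMemHardy p fun n => a n * X n ω := by
  rcases hX.boundedMeansEvent_zero_or_one a with h | h
  · filter_upwards [measure_eq_zero_iff_ae_notMem.1 h] with ω hω hmem
    exact hω (mem_boundedMeansEvent hp hmem)
  · exact absurd (hX.tsum_lt_top_of_boundedMeans h) ha

end Randomization

end InfHardy

end

theorem theorem2p1 {Ω : Type*} [MeasurableSpace Ω] (P : Measure Ω) [IsProbabilityMeasure P]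
    (X : ℕ+ → Ω → ℂ) (hX : InfHardy.IsStandardRandomSeq X P)
    (F : InfHardy.Ell1 → ℂ) (hF : InfHardy.IsAnalyticOnPolydisk F) :
    (F ∈ InfHardy.HardySpace 2 → ∀ p : ℝ, 1 ≤ p →
      ∀ᵐ ω ∂P, InfHardy.SeriesMemHardy p (InfHardy.randomCoeff F X ω)) ∧
    (F ∉ InfHardy.HardySpace 2 → ∀ p : ℝ, 1 ≤ p →
      ∀ᵐ ω ∂P, ¬ InfHardy.SeriesMemHardy p (InfHardy.randomCoeff F X ω)) := by
  rw [InfHardy.mem_hardySpace_two_iff hF]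
  exact ⟨fun h p hp => hX.isSubgaussianSeq.ae_seriesMemHardy h (zero_le_one.trans hp),
    fun h p hp => hX.isSubgaussianSeq.ae_not_seriesMemHardy h hp⟩
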